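/- **Setting.** Agents $i\in\mathcal V=\{1,\dots,N\}$ have dynamics $x_{i,k+1}=A_{i,k}x_{i,k}+B_{i,k}u_{i,k}$ in $\mathbb R^d$; agents in $\mathcal V_\ell\subseteq\mathcal V$ measure $y^\ell_{i,k}=H^\ell_{i,k}x_{i,k}$, and along the directed sensing edges $(i,j)\in\mathcal E_s$ one measures $y^r_{ij,k}=H^r_{ij,i,k}x_{i,k}+H^r_{ij,j,k}x_{j,k}$. The undirected communication graph $\mathcal G_c$ contains $\{i,j\}$ whenever $(i,j)\in\mathcal E_s$; $\mathcal N_i$ are the neighbours of $i$. Write $A_k,B_ku_k,H_k,R_k$ for the stacked quantities; norms are Euclidean/spectral. The gains $R^\ell_{i,k},R^r_{ij,k}$ are symmetric, uniformly bounded below by a positive multiple of the identity, and $\|R_{k+1}-R_k\|$ is bounded. Assume: * (boundedness) $\|A_k\|,\|B_ku_k\|,\|H_k\|,\|A_{k+1}-A_k\|,\|H_{k+1}-H_k\|$ are bounded uniformly in $k$; * (complete uniform observability) for some $K\ge1$, $\alpha_1,\alpha_2>0$ and all $k\ge K$, $\alpha_1I\preceq\sum_{t=k-K}^k\Phi(t,k-K)^\top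 H_t^\top H_t\Phi(t,k-K)\preceq\alpha_2I$, where $\Phi(t,s)=A_{t-1}\cdots A_s$; * (uniform invertibility) every $A_k$ is invertible and $\|A_k^{-1}\|\le\bar a_{\rm inv}$. **Observer.** Fix $\varepsilon\in(0,1]$, $\gamma\in(0,1)$, $\rho>0$, $\alpha\in(0,1)$, $H\ge1$. For $i\in\mathcal V$ and $\{i,j\}\in\mathcal E_c$ there are information contributions $S^\ell_i\in\mathbb R^{d\times d}$ and $S^e_{ij}\in\mathbb R^{2d\times2d}$ ($S^e_{ji}$ is $S^e_{ij}$ with its blocks reordered), initialized at positive semidefinite prior values whose global sum $S_{0|-1}$ is positive definite. With $J^\ell_{i,k}=(H^\ell_{i,k})^\top R^\ell_{i,k}H^\ell_{i,k}$ (zero if $i\notin\mathcal V_\ell$) and $J^e_{ij,k}$ the sum of the analogous terms of the relative measurements $(i,j)$ and $(j,i)$ that exist, the update is $S_{k|k}=S_{k|k-1}+\varepsilon J_k$ and the prediction is $S_{k+1|k}=\gamma A_k^{-\top}S_{k|k}A_k^{-1}$, applied to every contribution with the corresponding blocks of $A_k$; globally $S_{k|k}=S_{k|k-1}+\varepsilon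 H_k^\top R_kH_k$. The local and pairwise innovations $b^\ell_{i,k},b^e_{ij,k}$ are obtained from the residuals of the measurements with respect to the prior estimate $\hat x_{k|k-1}$. Agent $i$ holds copies $\xi^{(i)}_i$ and $\xi^{(i)}_j$, $j\in\mathcal N_i$, with local cost $J_i=\tfrac12\xi_i^{(i)\top}S^\ell_{i,k|k}\xi^{(i)}_i-\xi_i^{(i)\top}b^\ell_{i,k}+\tfrac12\sum_{j\in\mathcal N_i}\bigl(\tfrac12\zeta_{ij}^\top S^e_{ij,k|k}\zeta_{ij}-\zeta_{ij}^\top b^e_{ij,k}\bigr)$, $\zeta_{ij}=(\xi^{(i)}_i,\xi^{(i)}_j)$, and dual variables $q_{ij,i},q_{ij,j}$, $j\in\mathcal N_i$, stacked in $q$. Let $A_q$ map the copies $\xi$ to the vector with entries $(ij,i)\mapsto\xi_i^{(i)}$, $(ij,j)\mapsto\xi_j^{(i)}$, let $P$ exchange the slots $(ij,l)$ and $(ji,l)$, let $H_{\rho,k}=\rho A_q^\top A_q+\nabla^2\sum_iJ_i$, let $\bar b_k$ be minus the linear part of $\sum_iJ_i$, and let $\Sigma$ select the own copies. One ADMM iteration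 is $$\hat\xi_{k,h}=H_{\rho,k}^{-1}(\bar b_k+A_q^\top q_{k,h}),\qquad q_{k,h+1}=(1-\alpha)q_{k,h}+\alpha P(-q_{k,h}+2\rho A_q\hat\xi_{k,h}),$$ that is, $q_{k,h+1}=(I-\alpha F_k)q_{k,h}+\alpha c_k$ with $F_k=I+P-2\rho PA_qH_{\rho,k}^{-1}A_q^\top$ and $c_k=2\rho PA_qH_{\rho,k}^{-1}\bar b_k$. In each observer step $H$ iterations are made with warm start $q_{k+1,0}=q_{k,H}$, and $\hat x_{k+1|k}=A_k(\hat x_{k|k-1}+\varepsilon\Sigma\hat\xi_{k,H})+B_ku_k$. Put $\tilde x_k=x_k-\hat x_{k|k-1}$ and $\mathcal Q_{{\rm eq},k}=\{q: F_kq=c_k\}$; $c_k=M_k\tilde x_k$ is linear in $\tilde x_k$. **Constants.** A tuple of numbers $\underline s_\varepsilon,\bar s_\varepsilon,\bar a,c_h,\bar F^\dagger,\bar M,\sigma>0$ and $\bar F_\Delta,\bar M_\Delta,c_\Phi$ is called valid if for all $k$: $\underline s_\varepsilon I\preceq S_{k|k-1}$, $S_{k|k}\preceq\bar s_\varepsilon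 I$, $\|A_k\|\le\bar a$, $\|\Sigma H_{\rho,k}^{-1}A_q^\top\|\le c_h$, $\|F_k^\dagger\|\le\bar F^\dagger$ (Moore–Penrose inverse), $\|F_{k+1}-F_k\|\le\bar F_\Delta$, $\|M_k\|\le\bar M$, $\|M_{k+1}-M_k\|\le\bar M_\Delta$, $\|A_kS_{k|k}^{-1}S_{k|k-1}\|\le c_\Phi$, and if $\sigma\ge\bar F^\dagger/\alpha$ and $\frac{1-\alpha}{\alpha\sigma^2}<1$. Put $$\mu=\sqrt{1-\tfrac{1-\alpha}{\alpha\sigma^2}},\quad c_{12}=\sqrt{\bar s_\varepsilon}\,\bar a\,c_h,\quad c_{21}=\bar F^\dagger\,\frac{\bar F_\Delta\bar F^\dagger\bar M+\bar M(1+c_\Phi)+\bar M_\Delta}{\sqrt{\underline s_\varepsilon}},\quad c_{22}=\bar F^\dagger\bar M\,\bar a\,c_h .$$ **Theorem.** (i) If $\gamma\,\bar a_{\rm inv}^2<1$ and $\sup_k\|R_k\|<\infty$, then valid constants exist. (ii) For all valid constants with $$\varepsilon<\frac{(1-\sqrt\gamma)(1-\mu^H)}{c_{12}c_{21}+(1-\sqrt\gamma)c_{22}},$$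 the set $\{(\tilde x,q):\tilde x=0,\ q\in\mathcal Q_{{\rm eq},k}\}$ is uniformly globally exponentially stable for the interconnection of plant, observer and ADMM. Precisely, there are $C>0$ and $\lambda\in(0,1)$ such that for every $k_0\ge0$, every solution on $k\ge k_0$ (with arbitrary $x_{k_0},\hat x_{k_0|k_0-1},q_{k_0,0}$) and every $k\ge k_0$, the set $\mathcal Q_{{\rm eq},k}$ and the set above are nonempty, $$\|\tilde x_k\|+\operatorname{dist}(q_{k,0},\mathcal Q_{{\rm eq},k})\le C\lambda^{k-k_0}\bigl(\|\tilde x_{k_0}\|+\operatorname{dist}(q_{k_0,0},\mathcal Q_{{\rm eq},k_0})\bigr),$$ and the Euclidean distance of $(\tilde x_k,q_{k,0})$ to the set above at time $k$ is at most $C\lambda^{k-k_0}$ times its distance to that set at time $k_0$. -/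

import Mathlib

open scoped Matrix Matrix.Norms.L2Operator

namespace DistObs

noncomputable section

/-! ## Generic linear algebra -/

/-- Block selection matrix: the `p`-th block column of the identity on `ι × Fin d`, so that
`(blockSel d p)ᵀ *ᵥ v` is the `p`-th block of `v`. -/
def blockSel {ι : Type*} [DecidableEq ι] (d : ℕ) (p : ι) : Matrix (ι × Fin d) (Fin d) ℝ :=
  Matrix.of fun r a => if r = (p, a) then 1 else 0

/-- The two block columns `[blockSel d p, blockSel d p']` side by side. -/
def pairSel {ι : Type*} [DecidableEq ι] (d : ℕ) (p p' : ι) :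
    Matrix (ι × Fin d) (Fin d ⊕ Fin d) ℝ :=
  Matrix.fromCols (blockSel d p) (blockSel d p')

/-- The `i`-th block of a stacked vector. -/
def block {ι : Type*} {d : ℕ} (v : ι × Fin d → ℝ) (i : ι) : Fin d → ℝ := fun a => v (i, a)

/-- A real vector, seen in the Euclidean space. -/
abbrev euc {ι : Type*} (v : ι → ℝ) : EuclideanSpace ℝ ι := WithLp.toLp 2 v

/-- `B` is the Moore-Penrose pseudo-inverse of the real matrix `A`. -/
def IsMoorePenrose {m n : Type*} [Fintype m] [Fintype n]
    (A : Matrix m n ℝ) (B : Matrix n m ℝ) : Prop :=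
  A * B * A = A ∧ B * A * B = B ∧ (A * B)ᵀ = A * B ∧ (B * A)ᵀ = B * A

/-! ## The network -/

variable {V : Type*} [Fintype V] [DecidableEq V]

/-- Multi-agent system with communication graph `G`: decoupled time-varying linear dynamics,
local measurements at the agents in `Vl`, relative measurements along the directed sensing
edges in `Es`. -/
structure Network (G : SimpleGraph V) (d m ql qr : ℕ) where
  /-- agents with a local measurement -/
  Vl : Finset V
  /-- directed sensing edges -/
  Es : Finset (V × V)
  /-- sensing neighbours can communicate -/
  sensing_adj : ∀ i j, (i, j) ∈ Es → G.Adj i j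
  /-- state matrices `A_{i,k}` -/
  A : ℕ → V → Matrix (Fin d) (Fin d) ℝ
  /-- input matrices `B_{i,k}` -/
  B : ℕ → V → Matrix (Fin d) (Fin m) ℝ
  /-- inputs `u_{i,k}` -/
  u : ℕ → V → Fin m → ℝ
  /-- local measurement matrices `H^ℓ_{i,k}` -/
  Hl : ℕ → V → Matrix (Fin ql) (Fin d) ℝ
  /-- `Hsrc k i j` is the coefficient of `x_i` in the relative measurement `(i, j)` -/
  Hsrc : ℕ → V → V → Matrix (Fin qr) (Fin d) ℝ
  /-- `Htgt k i j` is the coefficient of `x_j` in the relative measurement `(i, j)` -/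
  Htgt : ℕ → V → V → Matrix (Fin qr) (Fin d) ℝ

variable {G : SimpleGraph V} {d m ql qr : ℕ}

namespace Network

variable (net : Network G d m ql qr)

/-- Index type of the stacked measurement vector. -/
abbrev MeasIdx : Type _ :=
  ({i : V // i ∈ net.Vl} × Fin ql) ⊕ ({e : V × V // e ∈ net.Es} × Fin qr)

/-- The block-diagonal state matrix `A_k`. -/
def bigA (k : ℕ) : Matrix (V × Fin d) (V × Fin d) ℝ :=
  Matrix.of fun r c => if r.1 = c.1 then net.A k r.1 r.2 c.2 else 0

/-- The stacked input term `B_k u_k`. -/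
def bigBu (k : ℕ) : V × Fin d → ℝ := fun r => (net.B k r.1 *ᵥ net.u k r.1) r.2

/-- The stacked measurement matrix `H_k`. -/
def bigH (k : ℕ) : Matrix net.MeasIdx (V × Fin d) ℝ :=
  Matrix.of fun r c =>
    match r with
    | Sum.inl (i, a) => if c.1 = i.1 then net.Hl k i.1 a c.2 else 0
    | Sum.inr (e, a) =>
        (if c.1 = e.1.1 then net.Hsrc k e.1.1 e.1.2 a c.2 else 0) +
        (if c.1 = e.1.2 then net.Htgt k e.1.1 e.1.2 a c.2 else 0)

/-- State transition matrix: `transition k₀ n = A_{k₀+n-1} ⋯ A_{k₀}`. -/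
def transition (k₀ : ℕ) : ℕ → Matrix (V × Fin d) (V × Fin d) ℝ
  | 0 => 1
  | n + 1 => net.bigA (k₀ + n) * transition k₀ n

/-- Observability Gramian over the window `k-K, …, k` (used for `k ≥ K`). -/
def gramian (k K : ℕ) : Matrix (V × Fin d) (V × Fin d) ℝ :=
  ∑ t ∈ Finset.Icc (k - K) k,
    (net.transition (k - K) (t - (k - K)))ᵀ * (net.bigH t)ᵀ * net.bigH t *
      net.transition (k - K) (t - (k - K))

/-- Uniform boundedness of the system matrices and of their variation. -/
def UniformlyBounded : Prop :=
  ∃ a b h aΔ hΔ : ℝ, 0 < a ∧ 0 < b ∧ 0 < h ∧ 0 < aΔ ∧ 0 < hΔ ∧ ∀ k,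
    ‖net.bigA k‖ ≤ a ∧ ‖euc (net.bigBu k)‖ ≤ b ∧ ‖net.bigH k‖ ≤ h ∧
    ‖net.bigA (k + 1) - net.bigA k‖ ≤ aΔ ∧ ‖net.bigH (k + 1) - net.bigH k‖ ≤ hΔ

/-- Complete uniform observability. -/
def CompletelyUniformlyObservable : Prop :=
  ∃ K : ℕ, 1 ≤ K ∧ ∃ α₁ α₂ : ℝ, 0 < α₁ ∧ 0 < α₂ ∧ ∀ k, K ≤ k →
    (net.gramian k K - α₁ • (1 : Matrix (V × Fin d) (V × Fin d) ℝ)).PosSemidef ∧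
    (α₂ • (1 : Matrix (V × Fin d) (V × Fin d) ℝ) - net.gramian k K).PosSemidef

/-- Uniform invertibility of the state matrices, with bound `aInv` on the inverses. -/
def UniformlyInvertible (aInv : ℝ) : Prop :=
  0 < aInv ∧ ∀ k, IsUnit (net.bigA k) ∧ ‖(net.bigA k)⁻¹‖ ≤ aInv

/-- Local measurement of agent `i` when the network state is `x`. -/
def yl (k : ℕ) (x : V × Fin d → ℝ) (i : V) : Fin ql → ℝ := net.Hl k i *ᵥ block x i

/-- Relative measurement along `(i, j)` when the network state is `x`. -/
def yr (k : ℕ) (x : V × Fin d → ℝ) (i j : V) : Fin qr → ℝ :=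
  net.Hsrc k i j *ᵥ block x i + net.Htgt k i j *ᵥ block x j

/-- For an ordered pair of neighbours `e = (i, j)`: the measurement matrix `[H_i, H_j]` of the
sensing edge `(i, j)`. -/
def Hfwd (k : ℕ) (e : G.Dart) : Matrix (Fin qr) (Fin d ⊕ Fin d) ℝ :=
  Matrix.fromCols (net.Hsrc k e.fst e.snd) (net.Htgt k e.fst e.snd)

/-- For an ordered pair of neighbours `e = (i, j)`: the measurement matrix `[H_i, H_j]` of the
opposite sensing edge `(j, i)`, with the columns still ordered as `(i, j)`. -/
def Hbwd (k : ℕ) (e : G.Dart) : Matrix (Fin qr) (Fin d ⊕ Fin d) ℝ :=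
  Matrix.fromCols (net.Htgt k e.snd e.fst) (net.Hsrc k e.snd e.fst)

end Network

/-! ## The distributed observer -/

/-- Data of the observer: information gains, initial (prior) information contributions, and
tuning parameters. The pairwise contribution of `{i, j}` is stored with both orderings of its
blocks, one for each dart. -/
structure Observer (G : SimpleGraph V) (d ql qr : ℕ) where
  /-- gains `R^ℓ_{i,k}` -/
  Rl : ℕ → V → Matrix (Fin ql) (Fin ql) ℝ
  /-- gains `R^r_{ij,k}` -/
  Rr : ℕ → V → V → Matrix (Fin qr) (Fin qr) ℝ
  /-- local prior information contributions at time `0` -/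
  Sl0 : V → Matrix (Fin d) (Fin d) ℝ
  /-- pairwise prior information contributions at time `0` -/
  Se0 : G.Dart → Matrix (Fin d ⊕ Fin d) (Fin d ⊕ Fin d) ℝ
  /-- correction gain -/
  ε : ℝ
  /-- forgetting factor -/
  γ : ℝ
  /-- ADMM penalty -/
  ρ : ℝ
  /-- ADMM relaxation -/
  α : ℝ
  /-- number of ADMM iterations per observer step -/
  nIter : ℕ

/-- Index type of the stacked primal ADMM variable: `Sum.inl i` is the copy of the correction of
agent `i` held by agent `i`; `Sum.inr (i, j)` is the copy of the correction of `j` held by `i`. -/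
abbrev PrimalIdx (G : SimpleGraph V) (d : ℕ) : Type _ := (V ⊕ G.Dart) × Fin d

/-- Index type of the stacked dual ADMM variable: `Sum.inl (i, j)` is `q_{ij,i}` and
`Sum.inr (i, j)` is `q_{ij,j}`, both held by agent `i`. -/
abbrev DualIdx (G : SimpleGraph V) (d : ℕ) : Type _ := (G.Dart ⊕ G.Dart) × Fin d

/-- The involution of the dual slots exchanging the two holders of the same shared variable. -/
def dualSwap : G.Dart ⊕ G.Dart → G.Dart ⊕ G.Dart
  | Sum.inl e => Sum.inr e.symm
  | Sum.inr e => Sum.inl e.symm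

/-- The copy, held by the owner of a dual slot, of the variable that the slot refers to. -/
def dualVar : G.Dart ⊕ G.Dart → V ⊕ G.Dart
  | Sum.inl e => Sum.inl e.fst
  | Sum.inr e => Sum.inr e

/-- The permutation matrix `P`. -/
def permP (G : SimpleGraph V) (d : ℕ) : Matrix (DualIdx G d) (DualIdx G d) ℝ :=
  Matrix.of fun r c => if c = (dualSwap r.1, r.2) then 1 else 0

/-- The matrix `A_q`. -/
def matAq (G : SimpleGraph V) (d : ℕ) : Matrix (DualIdx G d) (PrimalIdx G d) ℝ :=
  Matrix.of fun r c => if c = (dualVar r.1, r.2) then 1 else 0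

/-- The matrix `Σ` selecting the agents' own copies. -/
def matSigma (G : SimpleGraph V) (d : ℕ) : Matrix (V × Fin d) (PrimalIdx G d) ℝ :=
  Matrix.of fun r c => if c = (Sum.inl r.1, r.2) then 1 else 0

/-- Selects the own copy of agent `i`. -/
def selOwn (G : SimpleGraph V) (d : ℕ) (i : V) : Matrix (PrimalIdx G d) (Fin d) ℝ :=
  blockSel d (Sum.inl i)

/-- For `e = (i, j)`: selects the copies of the corrections of `i` and `j` held by agent `i`. -/
def selEdge (d : ℕ) (e : G.Dart) : Matrix (PrimalIdx G d) (Fin d ⊕ Fin d) ℝ :=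
  pairSel d (Sum.inl e.fst) (Sum.inr e)

namespace Observer

variable [DecidableRel G.Adj] (net : Network G d m ql qr) (obs : Observer G d ql qr)

/-- The block-diagonal gain `R_k`. -/
def bigR (k : ℕ) : Matrix net.MeasIdx net.MeasIdx ℝ :=
  Matrix.of fun r c =>
    match r, c with
    | Sum.inl (i, a), Sum.inl (j, b) => if i = j then obs.Rl k i.1 a b else 0
    | Sum.inr (e, a), Sum.inr (f, b) => if e = f then obs.Rr k e.1.1 e.1.2 a b else 0
    | _, _ => 0

/-- Local information `(H^ℓ)ᵀ R^ℓ H^ℓ` provided by the measurement of agent `i`, if any. -/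
def Jl (k : ℕ) (i : V) : Matrix (Fin d) (Fin d) ℝ :=
  if i ∈ net.Vl then (net.Hl k i)ᵀ * obs.Rl k i * net.Hl k i else 0

/-- Pairwise information provided by the relative measurements along `(i, j)` and `(j, i)`. -/
def Je (k : ℕ) (e : G.Dart) : Matrix (Fin d ⊕ Fin d) (Fin d ⊕ Fin d) ℝ :=
  (if (e.fst, e.snd) ∈ net.Es then
    (net.Hfwd k e)ᵀ * obs.Rr k e.fst e.snd * net.Hfwd k e else 0) +
  (if (e.snd, e.fst) ∈ net.Es then
    (net.Hbwd k e)ᵀ * obs.Rr k e.snd e.fst * net.Hbwd k e else 0)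

/-- Local information contribution `S^ℓ_{i,k|k-1}`. -/
def SlPrior : ℕ → V → Matrix (Fin d) (Fin d) ℝ
  | 0, i => obs.Sl0 i
  | k + 1, i =>
      obs.γ • (((net.A k i)⁻¹)ᵀ * (SlPrior k i + obs.ε • obs.Jl net k i) * (net.A k i)⁻¹)

/-- Local information contribution `S^ℓ_{i,k|k}`. -/
def SlPost (k : ℕ) (i : V) : Matrix (Fin d) (Fin d) ℝ :=
  obs.SlPrior net k i + obs.ε • obs.Jl net k i

/-- `blkdiag(A_{i,k}, A_{j,k})` for `e = (i, j)`. -/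
def pairA (k : ℕ) (e : G.Dart) : Matrix (Fin d ⊕ Fin d) (Fin d ⊕ Fin d) ℝ :=
  Matrix.fromBlocks (net.A k e.fst) 0 0 (net.A k e.snd)

/-- Pairwise information contribution `S^e_{ij,k|k-1}`. -/
def SePrior : ℕ → G.Dart → Matrix (Fin d ⊕ Fin d) (Fin d ⊕ Fin d) ℝ
  | 0, e => obs.Se0 e
  | k + 1, e =>
      obs.γ • (((pairA net k e)⁻¹)ᵀ * (SePrior k e + obs.ε • obs.Je net k e) *
        (pairA net k e)⁻¹)

/-- Pairwise information contribution `S^e_{ij,k|k}`. -/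
def SePost (k : ℕ) (e : G.Dart) : Matrix (Fin d ⊕ Fin d) (Fin d ⊕ Fin d) ℝ :=
  obs.SePrior net k e + obs.ε • obs.Je net k e

/-- The initial global prior information matrix: the sum of all local and pairwise
contributions (each unordered pair occurs as two darts, hence the factor `1/2`). -/
def S0 : Matrix (V × Fin d) (V × Fin d) ℝ :=
  (∑ i : V, blockSel d i * obs.Sl0 i * (blockSel d i)ᵀ) +
  (1 / 2 : ℝ) • ∑ e : G.Dart, pairSel d e.fst e.snd * obs.Se0 e * (pairSel d e.fst e.snd)ᵀ

/-- The global prior information matrix `S_{k|k-1}`: measurement update followed by the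
prediction with exponential forgetting. -/
def SPrior : ℕ → Matrix (V × Fin d) (V × Fin d) ℝ
  | 0 => obs.S0
  | k + 1 =>
      obs.γ • (((net.bigA k)⁻¹)ᵀ *
        (SPrior k + obs.ε • ((net.bigH k)ᵀ * obs.bigR net k * net.bigH k)) * (net.bigA k)⁻¹)

/-- The global posterior information matrix `S_{k|k}`. -/
def SPost (k : ℕ) : Matrix (V × Fin d) (V × Fin d) ℝ :=
  obs.SPrior net k + obs.ε • ((net.bigH k)ᵀ * obs.bigR net k * net.bigH k)

/-- Local innovation `b^ℓ_{i,k}` (plant state `x`, prior estimate `xhat`). -/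
def bl (k : ℕ) (x xhat : V × Fin d → ℝ) (i : V) : Fin d → ℝ :=
  if i ∈ net.Vl then
    (net.Hl k i)ᵀ *ᵥ (obs.Rl k i *ᵥ (net.yl k x i - net.Hl k i *ᵥ block xhat i)) else 0

/-- Pairwise innovation `b^e_{ij,k}`. -/
def be (k : ℕ) (x xhat : V × Fin d → ℝ) (e : G.Dart) : Fin d ⊕ Fin d → ℝ :=
  (if (e.fst, e.snd) ∈ net.Es then
    (net.Hfwd k e)ᵀ *ᵥ (obs.Rr k e.fst e.snd *ᵥ
      (net.yr k x e.fst e.snd -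
        net.Hfwd k e *ᵥ Sum.elim (block xhat e.fst) (block xhat e.snd))) else 0) +
  (if (e.snd, e.fst) ∈ net.Es then
    (net.Hbwd k e)ᵀ *ᵥ (obs.Rr k e.snd e.fst *ᵥ
      (net.yr k x e.snd e.fst -
        net.Hbwd k e *ᵥ Sum.elim (block xhat e.fst) (block xhat e.snd))) else 0)

/-! ### The ADMM layer

Agent `i` has the local cost `J_i = φ_i(ξ_i) + (1/2) ∑_{j ∼ i} φ_{ij}(ξ_i, ξ_j)` on its own copies,
with `φ_i(ξ) = (1/2) ξᵀ S^ℓ_i ξ - ξᵀ b^ℓ_i` and `φ_{ij}(ξ) = (1/2) ξᵀ S^e_{ij} ξ - ξᵀ b^e_{ij}`.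
The primal step minimizes
`∑_i J_i(ξ) - qᵀ A_q ξ + (ρ/2) ∑_i (|N_i| ‖ξ_i^{(i)}‖² + ∑_{j ∼ i} ‖ξ_j^{(i)}‖²)`
over all copies `ξ`; its Hessian is `Hrho` and its minimizer is `primal`. -/

/-- The Hessian `H_{ρ,k}` of the primal step, block diagonal over the agents. -/
def Hrho (k : ℕ) : Matrix (PrimalIdx G d) (PrimalIdx G d) ℝ :=
  obs.ρ • Matrix.diagonal (fun r : PrimalIdx G d =>
    match r.1 with
    | Sum.inl i => (G.degree i : ℝ)
    | Sum.inr _ => 1) +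
  (∑ i : V, selOwn G d i * obs.SlPost net k i * (selOwn G d i)ᵀ) +
  (1 / 2 : ℝ) • ∑ e : G.Dart, selEdge d e * obs.SePost net k e * (selEdge d e)ᵀ

/-- The linear term `b̄_k` of the primal step. -/
def bBar (k : ℕ) (x xhat : V × Fin d → ℝ) : PrimalIdx G d → ℝ :=
  (∑ i : V, selOwn G d i *ᵥ obs.bl net k x xhat i) +
  (1 / 2 : ℝ) • ∑ e : G.Dart, selEdge d e *ᵥ obs.be net k x xhat e

/-- The primal step: `H_{ρ,k}⁻¹ (b̄_k + A_qᵀ q)`. -/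
def primal (k : ℕ) (x xhat : V × Fin d → ℝ) (q : DualIdx G d → ℝ) : PrimalIdx G d → ℝ :=
  (obs.Hrho net k)⁻¹ *ᵥ (obs.bBar net k x xhat + (matAq G d)ᵀ *ᵥ q)

/-- The dual step. Agent `i` updates `q_{ij,i}` and `q_{ij,j}` with the dual variables and the
copies held by its neighbour `j`. -/
def dualStep (k : ℕ) (x xhat : V × Fin d → ℝ) (q : DualIdx G d → ℝ) : DualIdx G d → ℝ
  | (Sum.inl e, a) =>
      (1 - obs.α) * q (Sum.inl e, a) + obs.α *
        (-q (Sum.inr e.symm, a) + 2 * obs.ρ * obs.primal net k x xhat q (Sum.inr e.symm, a))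
  | (Sum.inr e, a) =>
      (1 - obs.α) * q (Sum.inr e, a) + obs.α *
        (-q (Sum.inl e.symm, a) + 2 * obs.ρ * obs.primal net k x xhat q (Sum.inl e.snd, a))

/-- The matrix `F_k`, for which the dual step reads `q ↦ (I - α F_k) q + α c_k`. -/
def matF (k : ℕ) : Matrix (DualIdx G d) (DualIdx G d) ℝ :=
  1 + permP G d - (2 * obs.ρ) • (permP G d * matAq G d * (obs.Hrho net k)⁻¹ * (matAq G d)ᵀ)

/-- The vector `c_k`. -/
def vecC (k : ℕ) (x xhat : V × Fin d → ℝ) : DualIdx G d → ℝ :=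
  (2 * obs.ρ) • ((permP G d * matAq G d * (obs.Hrho net k)⁻¹) *ᵥ obs.bBar net k x xhat)

/-- The equilibrium set `Q_{eq,k}` of the ADMM iteration at observer step `k`. -/
def Qeq (k : ℕ) (x xhat : V × Fin d → ℝ) : Set (EuclideanSpace ℝ (DualIdx G d)) :=
  {q | obs.matF net k *ᵥ q.ofLp = obs.vecC net k x xhat}

/-- A solution of the interconnection of plant, observer and ADMM layer from time `k₀` on:
`x k` is the plant state, `xhat k` the prior estimate, `q k h` the dual variable after `h` ADMM
iterations in observer step `k`. -/
structure IsSolution (k₀ : ℕ) (x xhat : ℕ → V × Fin d → ℝ) (q : ℕ → ℕ → DualIdx G d → ℝ) :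
    Prop where
  plant : ∀ k, k₀ ≤ k → x (k + 1) = net.bigA k *ᵥ x k + net.bigBu k
  dual : ∀ k, k₀ ≤ k → ∀ h, h < obs.nIter →
    q k (h + 1) = obs.dualStep net k (x k) (xhat k) (q k h)
  warm : ∀ k, k₀ ≤ k → q (k + 1) 0 = q k obs.nIter
  estimate : ∀ k, k₀ ≤ k → xhat (k + 1) =
    net.bigA k *ᵥ (xhat k + obs.ε •
      (matSigma G d *ᵥ
        obs.primal net k (x k) (xhat k) (q k obs.nIter))) + net.bigBu k

/-- The set `{(x̃, q) | x̃ = 0, q ∈ Q_{eq,k}}`, where `x` is the plant state at time `k` and the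
prior estimate corresponding to the error `x̃` is `x - x̃`. -/
def targetSet (k : ℕ) (x : V × Fin d → ℝ) :
    Set (WithLp 2 (EuclideanSpace ℝ (V × Fin d) × EuclideanSpace ℝ (DualIdx G d))) :=
  {p | p.fst = 0 ∧ p.snd ∈ obs.Qeq net k x (x - p.fst.ofLp)}

/-- Admissible observer data: parameter ranges, uniformly positive definite gains with bounded
variation, positive semidefinite initial contributions with positive definite sum. -/
structure Admissible : Prop where
  ε_pos : 0 < obs.ε
  ε_le : obs.ε ≤ 1
  γ_pos : 0 < obs.γ
  γ_lt : obs.γ < 1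
  ρ_pos : 0 < obs.ρ
  α_pos : 0 < obs.α
  α_lt : obs.α < 1
  nIter_pos : 1 ≤ obs.nIter
  gain_l : ∃ r : ℝ, 0 < r ∧ ∀ k, ∀ i ∈ net.Vl,
    (obs.Rl k i - r • (1 : Matrix (Fin ql) (Fin ql) ℝ)).PosSemidef
  gain_r : ∃ r : ℝ, 0 < r ∧ ∀ k, ∀ i j, (i, j) ∈ net.Es →
    (obs.Rr k i j - r • (1 : Matrix (Fin qr) (Fin qr) ℝ)).PosSemidef
  gain_var : ∃ r : ℝ, ∀ k, ‖obs.bigR net (k + 1) - obs.bigR net k‖ ≤ r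
  init_l : ∀ i, (obs.Sl0 i).PosSemidef
  init_e : ∀ e, (obs.Se0 e).PosSemidef
  init_symm : ∀ e : G.Dart, obs.Se0 e.symm = (obs.Se0 e).submatrix Sum.swap Sum.swap
  init_pos : obs.S0.PosDef

/-! ### The constants of the small-gain condition -/

/-- The matrix `Φ_k = A_k S_{k|k}⁻¹ S_{k|k-1}` of the error dynamics with exact correction. -/
def errPhi (k : ℕ) : Matrix (V × Fin d) (V × Fin d) ℝ :=
  net.bigA k * (obs.SPost net k)⁻¹ * obs.SPrior net k

/-- The matrix `M_k` with `c_k = M_k x̃_k`. -/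
def matM (k : ℕ) : Matrix (DualIdx G d) (V × Fin d) ℝ :=
  (2 * obs.ρ) • (permP G d * matAq G d * (obs.Hrho net k)⁻¹ *
    ((∑ i : V, selOwn G d i * obs.Jl net k i * (blockSel d i)ᵀ) +
     (1 / 2 : ℝ) • ∑ e : G.Dart,
       selEdge d e * obs.Je net k e * (pairSel d e.fst e.snd)ᵀ))

end Observer

/-- Constants from which the gains of the small-gain condition are formed. -/
structure GainConstants where
  /-- lower bound on the information matrices -/
  sLo : ℝ
  /-- upper bound on the information matrices -/
  sHi : ℝ
  /-- bound on `A_k` -/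
  aBar : ℝ
  /-- gain from the distance to the ADMM equilibria to the correction error -/
  cH : ℝ
  /-- bound on the pseudo-inverse of `F_k` -/
  FDag : ℝ
  /-- bound on the variation of `F_k` -/
  FVar : ℝ
  /-- bound on `M_k` -/
  MBar : ℝ
  /-- bound on the variation of `M_k` -/
  MVar : ℝ
  /-- bound on `Φ_k` -/
  cPhi : ℝ
  /-- metric subregularity constant of the ADMM operator -/
  σ : ℝ

namespace GainConstants

variable (c : GainConstants)

/-- The gain `c₁₂`. -/
def c12 : ℝ := √c.sHi * c.aBar * c.cH

/-- The gain `c₂₁`. -/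
def c21 : ℝ :=
  c.FDag * (c.FVar * c.FDag * c.MBar / √c.sLo + (c.MBar * (1 + c.cPhi) + c.MVar) / √c.sLo)

/-- The gain `c₂₂`. -/
def c22 : ℝ := c.FDag * c.MBar * c.aBar * c.cH

/-- The contraction factor of one ADMM iteration with relaxation `α`. -/
def μ (α : ℝ) : ℝ := √(1 - (1 - α) / (α * c.σ ^ 2))

variable [DecidableRel G.Adj]

/-- The constants are valid uniform bounds, for all times, of the quantities they refer to. -/
structure Valid (net : Network G d m ql qr) (obs : Observer G d ql qr) : Prop where
  sLo_pos : 0 < c.sLo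
  sHi_pos : 0 < c.sHi
  aBar_pos : 0 < c.aBar
  cH_pos : 0 < c.cH
  FDag_pos : 0 < c.FDag
  MBar_pos : 0 < c.MBar
  σ_pos : 0 < c.σ
  info_lower : ∀ k,
    (obs.SPrior net k - c.sLo • (1 : Matrix (V × Fin d) (V × Fin d) ℝ)).PosSemidef
  info_upper : ∀ k,
    (c.sHi • (1 : Matrix (V × Fin d) (V × Fin d) ℝ) - obs.SPost net k).PosSemidef
  norm_A : ∀ k, ‖net.bigA k‖ ≤ c.aBar
  output_gain : ∀ k, ‖matSigma G d *
    (obs.Hrho net k)⁻¹ * (matAq G d)ᵀ‖ ≤ c.cH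
  pinv_F : ∀ k, ∃ Fp, IsMoorePenrose (obs.matF net k) Fp ∧ ‖Fp‖ ≤ c.FDag
  var_F : ∀ k, ‖obs.matF net (k + 1) - obs.matF net k‖ ≤ c.FVar
  norm_M : ∀ k, ‖obs.matM net k‖ ≤ c.MBar
  var_M : ∀ k, ‖obs.matM net (k + 1) - obs.matM net k‖ ≤ c.MVar
  norm_Phi : ∀ k, ‖obs.errPhi net k‖ ≤ c.cPhi
  subregular : c.FDag / obs.α ≤ c.σ
  contraction : 0 < 1 - (1 - obs.α) / (obs.α * c.σ ^ 2)

end GainConstants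

end

end DistObs

open DistObs

/-!
Write `Q_k` for the Hessian of the sum of the local costs on the primal copies (`hessPost`), and `E`
for the matrix that copies a global vector to all its holders (`copyE`). The pairwise and local
information contributions add up to the global information matrix, `Eᵀ Q_k E = S_{k|k}`
(`hessPost_global`), and `H_{ρ,k}` and `F_k` are functions of `Q_k` alone.

*ADMM.* Only three facts about the network enter: the slot exchange `P` is a symmetric involution,
`P A_q E = A_q E`, and `P A_q z = A_q z` forces `z` to be consistent (`IsConsensus`). At an
equilibrium the copies are consistent and solve the global normal equations
(`equilibrium_primal`), so the own copies carry the exact centralized correction. Applied to a zero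
right-hand side this shows that the kernel of `F_k` is `{q | A_qᵀ q = 0, P q = -q}`, which does not
depend on `k` (`admmOp_mulVec_eq_zero_iff`). With `K` the orthogonal projection onto this kernel,
`F_k† = (F_k + K)⁻¹ - K`, which is continuous in `Q_k`. Moreover `1 - F_k` is nonexpansive, so the
relaxed iteration contracts the distance to the equilibria, `‖F_k†(F_k q - c_k)‖`, by the factor
`μ` (`infDist_relaxed_le`).

*Existence of the constants.* Observability over a window bounds `S_{k|k-1}` below, and
`γ ‖A_k⁻¹‖² < 1` bounds `S_{k|k}` above. As all contributions are positive semidefinite, the upper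
bound carries over to `Q_k`; hence the `Q_k` stay in a compact set on which `H_ρ⁻¹`, `F` and `F†`
are continuous (`exists_uniform_admm_bound`).

*Stability.* Let `U` be the estimation error in the norm of `S_{k|k-1}` and `D` the distance of the
dual variable to the equilibria. The exact error dynamics contracts `U` by `√γ`, and an inexact
dual variable perturbs it in proportion to `D`; conversely `D` grows only with the drift of the
equilibrium set, which is controlled by `U` and `D` because the kernel of `F_k` is constant. This
gives `U⁺ ≤ √γ U + ε c₁₂ μ^H D` and `D⁺ ≤ c₂₁ U + μ^H (1 + ε c₂₂) D`, and the hypothesis on `ε` is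
the small-gain condition under which a weighted sum of `U` and `D` decays exponentially
(`smallGain_decay`).
-/

namespace DistObs

/-! ### Quadratic forms and the Euclidean operator norm of real matrices -/

section LinearAlgebra

variable {m n p : Type*} [Fintype m] [Fintype n] [Fintype p]

lemma norm_euc_sq (v : n → ℝ) : ‖euc v‖ ^ 2 = v ⬝ᵥ v := by
  rw [EuclideanSpace.norm_sq_eq]
  simp [dotProduct, sq]

lemma norm_euc_add_le (v w : n → ℝ) : ‖euc (v + w)‖ ≤ ‖euc v‖ + ‖euc w‖ :=
  norm_add_le (euc v) (euc w)

lemma norm_euc_sub_le (v w : n → ℝ) : ‖euc (v - w)‖ ≤ ‖euc v‖ + ‖euc w‖ :=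
  norm_sub_le (euc v) (euc w)

lemma norm_euc_smul (t : ℝ) (v : n → ℝ) : ‖euc (t • v)‖ = |t| * ‖euc v‖ :=
  norm_smul t (euc v)

lemma norm_euc_mulVec_le [DecidableEq n] (A : Matrix m n ℝ) (v : n → ℝ) :
    ‖euc (A *ᵥ v)‖ ≤ ‖A‖ * ‖euc v‖ :=
  Matrix.l2_opNorm_mulVec A (euc v)

lemma opNorm_le_of_forall [DecidableEq n] (A : Matrix m n ℝ) {b : ℝ} (hb : 0 ≤ b)
    (h : ∀ v, ‖euc (A *ᵥ v)‖ ≤ b * ‖euc v‖) : ‖A‖ ≤ b := by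
  rw [Matrix.l2_opNorm_def]
  exact ContinuousLinearMap.opNorm_le_bound _ hb fun v => h v.ofLp

lemma opNorm_transpose [DecidableEq m] [DecidableEq n] (A : Matrix m n ℝ) : ‖Aᵀ‖ = ‖A‖ := by
  rw [← Matrix.conjTranspose_eq_transpose_of_trivial, Matrix.l2_opNorm_conjTranspose]

lemma dotProduct_le_norm (v w : n → ℝ) : v ⬝ᵥ w ≤ ‖euc v‖ * ‖euc w‖ := by
  have h := real_inner_le_norm (euc w) (euc v)
  rw [EuclideanSpace.inner_eq_star_dotProduct] at h
  simpa [mul_comm] using h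

lemma dotProduct_mulVec_le [DecidableEq n] (A : Matrix n n ℝ) (v : n → ℝ) :
    v ⬝ᵥ (A *ᵥ v) ≤ ‖A‖ * ‖euc v‖ ^ 2 := by
  have h1 := dotProduct_le_norm v (A *ᵥ v)
  have h2 := mul_le_mul_of_nonneg_left (norm_euc_mulVec_le A v) (norm_nonneg (euc v))
  nlinarith

lemma posSemidef_iff_real {M : Matrix n n ℝ} :
    M.PosSemidef ↔ Mᵀ = M ∧ ∀ v, 0 ≤ v ⬝ᵥ (M *ᵥ v) := by
  rw [Matrix.posSemidef_iff_dotProduct_mulVec, Matrix.IsHermitian,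
    Matrix.conjTranspose_eq_transpose_of_trivial]
  simp only [star_trivial]

lemma posSemidef_sub_smul_one_iff [DecidableEq n] {M : Matrix n n ℝ} {c : ℝ} :
    (M - c • (1 : Matrix n n ℝ)).PosSemidef ↔
      Mᵀ = M ∧ ∀ v, c * ‖euc v‖ ^ 2 ≤ v ⬝ᵥ (M *ᵥ v) := by
  rw [posSemidef_iff_real]
  simp [Matrix.sub_mulVec, Matrix.smul_mulVec, norm_euc_sq]

lemma posSemidef_smul_one_sub_iff [DecidableEq n] {M : Matrix n n ℝ} {c : ℝ} :
    (c • (1 : Matrix n n ℝ) - M).PosSemidef ↔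
      Mᵀ = M ∧ ∀ v, v ⬝ᵥ (M *ᵥ v) ≤ c * ‖euc v‖ ^ 2 := by
  rw [posSemidef_iff_real]
  simp [Matrix.sub_mulVec, Matrix.smul_mulVec, norm_euc_sq]

lemma dotProduct_mulVec_symm {M : Matrix n n ℝ} (hM : Mᵀ = M) (v w : n → ℝ) :
    v ⬝ᵥ (M *ᵥ w) = w ⬝ᵥ (M *ᵥ v) := by
  rw [Matrix.dotProduct_mulVec, ← Matrix.mulVec_transpose, hM, dotProduct_comm]

lemma dotProduct_mulVec_transpose (A : Matrix m n ℝ) (v : m → ℝ) (w : n → ℝ) :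
    v ⬝ᵥ (A *ᵥ w) = w ⬝ᵥ (Aᵀ *ᵥ v) := by
  rw [Matrix.dotProduct_mulVec, ← Matrix.mulVec_transpose, dotProduct_comm]

lemma dotProduct_congruence (A : Matrix m n ℝ) (M : Matrix m m ℝ) (v : n → ℝ) :
    v ⬝ᵥ ((Aᵀ * M * A) *ᵥ v) = (A *ᵥ v) ⬝ᵥ (M *ᵥ (A *ᵥ v)) := by
  rw [← Matrix.mulVec_mulVec, ← Matrix.mulVec_mulVec, dotProduct_mulVec_transpose,
    Matrix.transpose_transpose, dotProduct_comm]

lemma posSemidef_congruence {M : Matrix m m ℝ} (hM : M.PosSemidef) (A : Matrix m n ℝ) :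
    (Aᵀ * M * A).PosSemidef := by
  simpa using hM.conjTranspose_mul_mul_same A

lemma posSemidef_congruence' {M : Matrix m m ℝ} (hM : M.PosSemidef) (A : Matrix n m ℝ) :
    (A * M * Aᵀ).PosSemidef := by
  simpa using hM.mul_mul_conjTranspose_same A

open scoped MatrixOrder in
lemma exists_factor_of_posSemidef [DecidableEq n] {M : Matrix n n ℝ} (hM : M.PosSemidef) :
    ∃ B : Matrix n n ℝ, M = Bᵀ * B := by
  obtain ⟨B, hB⟩ := CStarAlgebra.nonneg_iff_eq_star_mul_self.mp hM.nonneg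
  exact ⟨B, by rw [hB, Matrix.star_eq_conjTranspose, Matrix.conjTranspose_eq_transpose_of_trivial]⟩

lemma quadForm_factor (B : Matrix m n ℝ) (v : n → ℝ) :
    v ⬝ᵥ ((Bᵀ * B) *ᵥ v) = ‖euc (B *ᵥ v)‖ ^ 2 := by
  rw [norm_euc_sq, ← Matrix.mulVec_mulVec, dotProduct_mulVec_transpose, Matrix.transpose_transpose]

lemma opNorm_le_of_posSemidef [DecidableEq n] {M : Matrix n n ℝ} {b : ℝ} (hb : 0 ≤ b)
    (hM : M.PosSemidef) (h : ∀ v, v ⬝ᵥ (M *ᵥ v) ≤ b * ‖euc v‖ ^ 2) : ‖M‖ ≤ b := by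
  obtain ⟨B, rfl⟩ := exists_factor_of_posSemidef hM
  have hB : ‖B‖ ≤ √b := by
    refine opNorm_le_of_forall _ (Real.sqrt_nonneg _) fun v => ?_
    have := h v
    rw [quadForm_factor] at this
    refine abs_le_of_sq_le_sq' ?_ (by positivity) |>.2
    rwa [mul_pow, Real.sq_sqrt hb]
  rw [← Matrix.conjTranspose_eq_transpose_of_trivial, Matrix.l2_opNorm_conjTranspose_mul_self]
  calc ‖B‖ * ‖B‖ ≤ √b * √b := by gcongr
    _ = b := Real.mul_self_sqrt hb

/-- Triangle inequality for the seminorm of a positive semidefinite matrix. -/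
lemma sqrt_quadForm_add_le [DecidableEq n] {M : Matrix n n ℝ} (hM : M.PosSemidef) (v w : n → ℝ) :
    √((v + w) ⬝ᵥ (M *ᵥ (v + w))) ≤ √(v ⬝ᵥ (M *ᵥ v)) + √(w ⬝ᵥ (M *ᵥ w)) := by
  obtain ⟨B, rfl⟩ := exists_factor_of_posSemidef hM
  simp only [quadForm_factor, Real.sqrt_sq (norm_nonneg _)]
  rw [Matrix.mulVec_add]
  exact norm_euc_add_le _ _

lemma exists_lower_bound_of_posDef [DecidableEq n] {M : Matrix n n ℝ} (hM : M.PosDef) :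
    ∃ c : ℝ, 0 < c ∧ ∀ v, c * ‖euc v‖ ^ 2 ≤ v ⬝ᵥ (M *ᵥ v) := by
  obtain ⟨B, rfl⟩ := exists_factor_of_posSemidef hM.posSemidef
  have hu : IsUnit B := by
    have := hM.isUnit
    rw [Matrix.isUnit_iff_isUnit_det] at this ⊢
    rw [Matrix.det_mul] at this
    exact isUnit_of_mul_isUnit_right this
  refine ⟨((‖B⁻¹‖ + 1) ^ 2)⁻¹, by positivity, fun v => ?_⟩
  rw [quadForm_factor, inv_mul_le_iff₀ (by positivity), ← mul_pow]
  gcongr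
  calc ‖euc v‖ = ‖euc (B⁻¹ *ᵥ (B *ᵥ v))‖ := by
        rw [Matrix.mulVec_mulVec, Matrix.nonsing_inv_mul _
          ((Matrix.isUnit_iff_isUnit_det _).mp hu), Matrix.one_mulVec]
    _ ≤ ‖B⁻¹‖ * ‖euc (B *ᵥ v)‖ := norm_euc_mulVec_le _ _
    _ ≤ (‖B⁻¹‖ + 1) * ‖euc (B *ᵥ v)‖ := by gcongr; linarith

lemma posDef_of_lower_bound {M : Matrix n n ℝ} {c : ℝ} (hc : 0 < c) (hM : Mᵀ = M)
    (h : ∀ v, c * ‖euc v‖ ^ 2 ≤ v ⬝ᵥ (M *ᵥ v)) : M.PosDef := by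
  refine Matrix.PosDef.of_dotProduct_mulVec_pos hM fun {v} hv => ?_
  have : 0 < ‖euc v‖ := by
    rw [norm_pos_iff]
    intro h0
    exact hv (by simpa using congrArg WithLp.ofLp h0)
  simp only [star_trivial]
  exact lt_of_lt_of_le (by positivity) (h v)

lemma opNorm_inv_le_of_lower_bound [DecidableEq n] {M : Matrix n n ℝ} {c : ℝ} (hc : 0 < c)
    (hM : Mᵀ = M) (h : ∀ v, c * ‖euc v‖ ^ 2 ≤ v ⬝ᵥ (M *ᵥ v)) : ‖M⁻¹‖ ≤ c⁻¹ := by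
  have hu := (Matrix.isUnit_iff_isUnit_det _).mp (posDef_of_lower_bound hc hM h).isUnit
  refine opNorm_le_of_forall _ (by positivity) fun v => ?_
  set w := M⁻¹ *ᵥ v with hw
  have hv : v = M *ᵥ w := by
    rw [hw, Matrix.mulVec_mulVec, Matrix.mul_nonsing_inv _ hu, Matrix.one_mulVec]
  have h1 := (h w).trans (dotProduct_le_norm w (M *ᵥ w))
  rw [← hv] at h1
  rcases (norm_nonneg (euc w)).eq_or_lt with h0 | h0
  · rw [← h0]; positivity
  · rw [le_inv_mul_iff₀ hc]
    exact le_of_mul_le_mul_left (by linarith) h0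

/-- Measurement updates do not increase the error in the information norm: with `S ≥ T`, the map
`S⁻¹ T` sends the `T`-seminorm ball into the `S`-seminorm ball. -/
lemma quadForm_inv_mul_le [DecidableEq n] {S T : Matrix n n ℝ} (hS : S.PosDef) (hT : Tᵀ = T)
    (hST : ∀ v, v ⬝ᵥ (T *ᵥ v) ≤ v ⬝ᵥ (S *ᵥ v)) (hT0 : ∀ v, 0 ≤ v ⬝ᵥ (T *ᵥ v)) (v : n → ℝ) :
    ((S⁻¹ * T) *ᵥ v) ⬝ᵥ (S *ᵥ ((S⁻¹ * T) *ᵥ v)) ≤ v ⬝ᵥ (T *ᵥ v) := by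
  have hu := (Matrix.isUnit_iff_isUnit_det _).mp hS.isUnit
  set w := (S⁻¹ * T) *ᵥ v with hw
  have hSw : S *ᵥ w = T *ᵥ v := by
    rw [hw, Matrix.mulVec_mulVec, ← mul_assoc, Matrix.mul_nonsing_inv _ hu, one_mul]
  have h1 := hT0 (v - w)
  have h2 := hST w
  have h3 := dotProduct_mulVec_symm hT v w
  simp only [Matrix.mulVec_sub, sub_dotProduct, dotProduct_sub] at h1
  rw [hSw] at h2 ⊢
  linarith

end LinearAlgebra

end DistObs

namespace DistObs

/-! ### Solution sets of linear equations and the Moore-Penrose inverse -/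

section PseudoInverse

variable {n : Type*} [Fintype n] {F B : Matrix n n ℝ}

lemma norm_pinv_mul_self_mulVec_le (h : IsMoorePenrose F B) (v : n → ℝ) :
    ‖euc (B *ᵥ (F *ᵥ v))‖ ≤ ‖euc v‖ := by
  obtain ⟨h1, -, -, h4⟩ := h
  set p := B *ᵥ (F *ᵥ v) with hp
  have hp' : p = (B * F) *ᵥ v := by rw [hp, Matrix.mulVec_mulVec]
  have hpp : p ⬝ᵥ p = p ⬝ᵥ v := by
    have e1 : (B * F) *ᵥ p = p := by
      rw [hp', Matrix.mulVec_mulVec]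
      congr 1
      rw [mul_assoc, ← mul_assoc F, h1]
    calc p ⬝ᵥ p = p ⬝ᵥ ((B * F) *ᵥ v) := by rw [← hp']
      _ = v ⬝ᵥ ((B * F) *ᵥ p) := dotProduct_mulVec_symm h4 _ _
      _ = p ⬝ᵥ v := by rw [e1, dotProduct_comm]
  have h5 := dotProduct_le_norm p v
  rw [← hpp, ← norm_euc_sq] at h5
  rcases (norm_nonneg (euc p)).eq_or_lt with h0 | h0
  · rw [← h0]; positivity
  · exact le_of_mul_le_mul_left (by linarith) h0

/-- The solution set of `F q = c`. -/
def solSet (F : Matrix n n ℝ) (c : n → ℝ) : Set (EuclideanSpace ℝ n) := {q | F *ᵥ q.ofLp = c}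

/-- The orthogonal projection of `q` onto the solution set of a solvable system. -/
lemma sub_pinv_mem_solSet (h : IsMoorePenrose F B) {c : n → ℝ} (hc : ∃ q, F *ᵥ q = c)
    (q : n → ℝ) : euc (q - B *ᵥ (F *ᵥ q - c)) ∈ solSet F c := by
  obtain ⟨r, rfl⟩ := hc
  change F *ᵥ (q - B *ᵥ (F *ᵥ q - F *ᵥ r)) = F *ᵥ r
  rw [← Matrix.mulVec_sub, Matrix.mulVec_sub, Matrix.mulVec_mulVec, Matrix.mulVec_mulVec, h.1,
    ← Matrix.mulVec_sub, sub_sub_cancel]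

lemma infDist_solSet (h : IsMoorePenrose F B) {c : n → ℝ} (hc : ∃ q, F *ᵥ q = c) (q : n → ℝ) :
    Metric.infDist (euc q) (solSet F c) = ‖euc (B *ᵥ (F *ᵥ q - c))‖ := by
  apply le_antisymm
  · refine (Metric.infDist_le_dist_of_mem (sub_pinv_mem_solSet h hc q)).trans_eq ?_
    rw [dist_eq_norm, ← WithLp.toLp_sub, sub_sub_cancel]
  · refine (Metric.le_infDist ⟨_, sub_pinv_mem_solSet h hc q⟩).2 fun r hr => ?_
    have hr' : F *ᵥ r.ofLp = c := hr
    rw [dist_eq_norm, ← hr', ← Matrix.mulVec_sub]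
    exact norm_pinv_mul_self_mulVec_le h (q - r.ofLp)

end PseudoInverse

/-! ### ADMM on an abstract consensus problem -/

section Admm

variable {n p q : Type*} [Fintype n] [Fintype p] [Fintype q]
  [DecidableEq p] [DecidableEq q]

/-- Consensus structure of the edge-based ADMM: `A` writes the copies into the dual slots, the
symmetric involution `P` exchanges slots referring to the same variable, `E` copies a global vector
to all its holders, and `Sg` reads it off again. The vectors `z` with `P A z = A z` are
exactly the consistent ones. -/
structure IsConsensus (P : Matrix q q ℝ) (A : Matrix q p ℝ) (E : Matrix p n ℝ)
    (Sg : Matrix n p ℝ) : Prop where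
  transpose_swap : Pᵀ = P
  swap_mul_swap : P * P = 1
  swap_copies : P * A * E = A * E
  eq_copies : ∀ z, P *ᵥ (A *ᵥ z) = A *ᵥ z → E *ᵥ (Sg *ᵥ z) = z

/-- Hessian of the augmented primal step for the cost Hessian `Q`. -/
noncomputable def admmHess (ρ : ℝ) (A : Matrix q p ℝ) (Q : Matrix p p ℝ) : Matrix p p ℝ :=
  ρ • (Aᵀ * A) + Q

/-- The residual operator `F` of the ADMM dual iteration for the cost Hessian `Q`. -/
noncomputable def admmOp (ρ : ℝ) (P : Matrix q q ℝ) (A : Matrix q p ℝ) (Q : Matrix p p ℝ) : Matrix q q ℝ :=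
  1 + P - (2 * ρ) • (P * A * (admmHess ρ A Q)⁻¹ * Aᵀ)

variable {P : Matrix q q ℝ} {A : Matrix q p ℝ} {E : Matrix p n ℝ} {Sg : Matrix n p ℝ} {ρ : ℝ}
  {Q : Matrix p p ℝ}

omit [DecidableEq p] [DecidableEq q] in
lemma quadForm_admmHess (z : p → ℝ) :
    z ⬝ᵥ (admmHess ρ A Q *ᵥ z) = ρ * ‖euc (A *ᵥ z)‖ ^ 2 + z ⬝ᵥ (Q *ᵥ z) := by
  rw [admmHess, Matrix.add_mulVec, dotProduct_add, Matrix.smul_mulVec, dotProduct_smul,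
    quadForm_factor, smul_eq_mul]

omit [DecidableEq p] in
/-- The penalty controls all shared copies, and the global information matrix `Eᵀ Q E` controls
the vectors on which the penalty vanishes. -/
lemma admmHess_posDef (h : IsConsensus P A E Sg) (hρ : 0 < ρ) (hQ : Q.PosSemidef)
    (hS : (Eᵀ * Q * E).PosDef) : (admmHess ρ A Q).PosDef := by
  refine Matrix.PosDef.of_dotProduct_mulVec_pos ?_ fun {z} hz => ?_
  · rw [Matrix.IsHermitian, Matrix.conjTranspose_eq_transpose_of_trivial, admmHess,
      Matrix.transpose_add, Matrix.transpose_smul, Matrix.transpose_mul, Matrix.transpose_transpose,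
      (posSemidef_iff_real.mp hQ).1]
  · rw [star_trivial, quadForm_admmHess]
    have h0 := (posSemidef_iff_real.mp hQ).2 z
    by_cases hA : A *ᵥ z = 0
    · have hc := h.eq_copies z (by rw [hA, Matrix.mulVec_zero])
      have hx : Sg *ᵥ z ≠ 0 := by
        intro hx
        rw [hx, Matrix.mulVec_zero] at hc
        exact hz hc.symm
      have := hS.dotProduct_mulVec_pos hx
      rw [star_trivial, dotProduct_congruence, hc] at this
      rw [hA]
      simpa using this
    · have : 0 < ‖euc (A *ᵥ z)‖ := by
        rw [norm_pos_iff]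
        intro h0
        exact hA (by simpa using congrArg WithLp.ofLp h0)
      positivity

lemma isUnit_det_admmHess (h : IsConsensus P A E Sg) (hρ : 0 < ρ) (hQ : Q.PosSemidef)
    (hS : (Eᵀ * Q * E).PosDef) : IsUnit (admmHess ρ A Q).det :=
  (Matrix.isUnit_iff_isUnit_det _).mp (admmHess_posDef h hρ hQ hS).isUnit

/-- At an ADMM equilibrium the copies are consistent, and the common value solves the global
normal equations. -/
lemma equilibrium_primal (h : IsConsensus P A E Sg) (hρ : 0 < ρ) (hQ : Q.PosSemidef)
    (hS : (Eᵀ * Q * E).PosDef) (b : p → ℝ) (v : q → ℝ)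
    (hv : admmOp ρ P A Q *ᵥ v = (2 * ρ) • ((P * A * (admmHess ρ A Q)⁻¹) *ᵥ b)) :
    let z := (admmHess ρ A Q)⁻¹ *ᵥ (b + Aᵀ *ᵥ v)
    v + P *ᵥ v = (2 * ρ) • (A *ᵥ z) ∧ E *ᵥ (Sg *ᵥ z) = z ∧
      (Eᵀ * Q * E) *ᵥ (Sg *ᵥ z) = Eᵀ *ᵥ b := by
  intro z
  have hu := isUnit_det_admmHess h hρ hQ hS
  have hPP : ∀ w, P *ᵥ (P *ᵥ w) = w := fun w => by
    rw [Matrix.mulVec_mulVec, h.swap_mul_swap, Matrix.one_mulVec]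
  have h1 : v + P *ᵥ v = (2 * ρ) • (P *ᵥ (A *ᵥ z)) := by
    simp only [admmOp, Matrix.sub_mulVec, Matrix.add_mulVec, Matrix.one_mulVec, Matrix.smul_mulVec,
      ← Matrix.mulVec_mulVec] at hv
    rw [sub_eq_iff_eq_add] at hv
    simp only [z, Matrix.mulVec_add, smul_add]
    exact hv
  have h2 : v + P *ᵥ v = (2 * ρ) • (A *ᵥ z) := by
    have := congrArg (P *ᵥ ·) h1
    simp only [Matrix.mulVec_add, Matrix.mulVec_smul, hPP] at this
    rw [← this, add_comm]
  have h3 : P *ᵥ (A *ᵥ z) = A *ᵥ z := by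
    have := h1.symm.trans h2
    exact smul_right_injective _ (by positivity : (2 * ρ) ≠ 0) this
  have hz := h.eq_copies z h3
  refine ⟨h2, hz, ?_⟩
  have h4 : admmHess ρ A Q *ᵥ z = b + Aᵀ *ᵥ v := by
    simp only [z]
    rw [Matrix.mulVec_mulVec, Matrix.mul_nonsing_inv _ hu, Matrix.one_mulVec]
  -- both holders of a shared variable enter `Eᵀ Aᵀ` alike
  have h5 : Eᵀ *ᵥ (Aᵀ *ᵥ (P *ᵥ v)) = Eᵀ *ᵥ (Aᵀ *ᵥ v) := by
    have := congrArg Matrix.transpose h.swap_copies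
    simp only [Matrix.transpose_mul, h.transpose_swap] at this
    simp only [Matrix.mulVec_mulVec, this]
  have h6 : Eᵀ *ᵥ (Aᵀ *ᵥ v) = ρ • (Eᵀ *ᵥ (Aᵀ *ᵥ (A *ᵥ z))) := by
    have := congrArg (fun w => Eᵀ *ᵥ (Aᵀ *ᵥ w)) h2
    simp only [Matrix.mulVec_add, Matrix.mulVec_smul, h5] at this
    rw [← two_smul ℝ, mul_smul] at this
    exact smul_right_injective _ (two_ne_zero : (2 : ℝ) ≠ 0) this
  have h7 := congrArg (Eᵀ *ᵥ ·) h4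
  simp only [admmHess, Matrix.add_mulVec, Matrix.mulVec_add, Matrix.smul_mulVec, Matrix.mulVec_smul,
    ← Matrix.mulVec_mulVec, h6] at h7
  rw [add_comm, add_right_cancel_iff] at h7
  rw [← Matrix.mulVec_mulVec, ← Matrix.mulVec_mulVec, hz]
  exact h7

/-- The kernel of the residual operator does not depend on the cost: it consists of the dual
variables that are antisymmetric under the swap and invisible to the primal step. -/
lemma admmOp_mulVec_eq_zero_iff (h : IsConsensus P A E Sg) (hρ : 0 < ρ) (hQ : Q.PosSemidef)
    (hS : (Eᵀ * Q * E).PosDef) (v : q → ℝ) :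
    admmOp ρ P A Q *ᵥ v = 0 ↔ Aᵀ *ᵥ v = 0 ∧ P *ᵥ v = -v := by
  classical
  constructor
  · intro hv
    obtain ⟨h1, h2, h3⟩ := equilibrium_primal h hρ hQ hS 0 v (by simpa using hv)
    set z := (admmHess ρ A Q)⁻¹ *ᵥ (0 + Aᵀ *ᵥ v) with hz
    have hu := (Matrix.isUnit_iff_isUnit_det _).mp hS.isUnit
    have hx : Sg *ᵥ z = 0 := by
      have := congrArg ((Eᵀ * Q * E)⁻¹ *ᵥ ·) h3
      simpa only [Matrix.mulVec_zero, Matrix.mulVec_mulVec _ (Eᵀ * Q * E)⁻¹,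
        Matrix.nonsing_inv_mul _ hu, Matrix.one_mulVec] using this
    have hz0 : z = 0 := by rw [← h2, hx, Matrix.mulVec_zero]
    constructor
    · have := congrArg (admmHess ρ A Q *ᵥ ·) hz
      simpa only [hz0, zero_add, Matrix.mulVec_zero, Matrix.mulVec_mulVec _ (admmHess ρ A Q),
        Matrix.mul_nonsing_inv _ (isUnit_det_admmHess h hρ hQ hS), Matrix.one_mulVec,
        eq_comm] using this
    · rw [hz0, Matrix.mulVec_zero, smul_zero] at h1
      exact eq_neg_of_add_eq_zero_right h1
  · rintro ⟨h1, h2⟩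
    simp [admmOp, Matrix.sub_mulVec, Matrix.add_mulVec, Matrix.smul_mulVec,
      ← Matrix.mulVec_mulVec, h1, h2]

/-- Orthogonal projection onto the dual variables annihilated by `Aᵀ` and `1 + P`. -/
structure IsKernelProj (P : Matrix q q ℝ) (A : Matrix q p ℝ) (K : Matrix q q ℝ) : Prop where
  transpose_eq : Kᵀ = K
  mul_left : Aᵀ * K = 0
  swap_mul : P * K = -K
  apply_of_mem : ∀ v, Aᵀ *ᵥ v = 0 → P *ᵥ v = -v → K *ᵥ v = v

omit [Fintype p] [DecidableEq p] in
lemma exists_isKernelProj (P : Matrix q q ℝ) (A : Matrix q p ℝ) : ∃ K, IsKernelProj P A K := by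
  let U : Submodule ℝ (EuclideanSpace ℝ q) :=
    { carrier := {v | Aᵀ *ᵥ v.ofLp = 0 ∧ P *ᵥ v.ofLp = -v.ofLp}
      add_mem' := by
        rintro a b ⟨ha, ha'⟩ ⟨hb, hb'⟩
        refine ⟨?_, ?_⟩
        · simp [Matrix.mulVec_add, ha, hb]
        · simp [Matrix.mulVec_add, ha', hb', add_comm]
      zero_mem' := by simp
      smul_mem' := by
        rintro c a ⟨ha, ha'⟩
        simp [Matrix.mulVec_smul, ha, ha'] }
  let T := Matrix.toEuclideanCLM (n := q) (𝕜 := ℝ)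
  let K := T.symm U.starProjection
  have hK : ∀ v : q → ℝ, K *ᵥ v = (U.starProjection (euc v)).ofLp := by
    intro v
    have : T K = U.starProjection := T.apply_symm_apply _
    rw [← this]
    rfl
  have hmem : ∀ v : q → ℝ, Aᵀ *ᵥ (K *ᵥ v) = 0 ∧ P *ᵥ (K *ᵥ v) = -(K *ᵥ v) := by
    intro v
    rw [hK]
    exact (U.starProjection_apply_mem (euc v) : _)
  refine ⟨K, ?_, ?_, ?_, ?_⟩
  · have h1 : star K = K := by
      have : star U.starProjection = U.starProjection := isSelfAdjoint_starProjection U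
      have hTK : T (star K) = T K := by
        rw [map_star T K, T.apply_symm_apply, this]
      exact EquivLike.injective T hTK
    rwa [Matrix.star_eq_conjTranspose, Matrix.conjTranspose_eq_transpose_of_trivial] at h1
  · refine Matrix.mulVec_injective ?_
    funext v
    simpa only [← Matrix.mulVec_mulVec, Matrix.zero_mulVec] using (hmem v).1
  · refine Matrix.mulVec_injective ?_
    funext v
    simpa only [← Matrix.mulVec_mulVec, Matrix.neg_mulVec] using (hmem v).2
  · intro v h1 h2
    rw [hK, Submodule.starProjection_eq_self_iff.mpr]
    exact ⟨h1, h2⟩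

namespace IsKernelProj

variable {K : Matrix q q ℝ}

omit [Fintype p] [DecidableEq p] [DecidableEq q] in
lemma mul_right (hK : IsKernelProj P A K) : K * A = 0 := by
  simpa [hK.transpose_eq] using congrArg Matrix.transpose hK.mul_left

omit [Fintype p] [DecidableEq p] [DecidableEq q] in
lemma mul_swap (hK : IsKernelProj P A K) (hP : Pᵀ = P) : K * P = -K := by
  simpa [hK.transpose_eq, hP] using congrArg Matrix.transpose hK.swap_mul

omit [Fintype p] [DecidableEq p] [DecidableEq q] in
lemma mul_self (hK : IsKernelProj P A K) : K * K = K := by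
  refine Matrix.mulVec_injective ?_
  funext v
  rw [← Matrix.mulVec_mulVec]
  refine hK.apply_of_mem _ ?_ ?_
  · rw [Matrix.mulVec_mulVec, hK.mul_left, Matrix.zero_mulVec]
  · rw [Matrix.mulVec_mulVec, hK.swap_mul, Matrix.neg_mulVec]

lemma admmOp_mul (hK : IsKernelProj P A K) : admmOp ρ P A Q * K = 0 := by
  rw [admmOp, sub_mul, add_mul, one_mul, hK.swap_mul, Matrix.smul_mul, Matrix.mul_assoc _ Aᵀ, hK.mul_left]
  simp

lemma mul_admmOp (hK : IsKernelProj P A K) (hP : Pᵀ = P) : K * admmOp ρ P A Q = 0 := by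
  rw [admmOp, mul_sub, mul_add, mul_one, hK.mul_swap hP, Matrix.mul_smul]
  have : K * (P * A * (admmHess ρ A Q)⁻¹ * Aᵀ) = 0 := by
    simp only [← Matrix.mul_assoc, hK.mul_swap hP, Matrix.neg_mul, hK.mul_right, Matrix.zero_mul,
      neg_zero]
  simp [this]

end IsKernelProj

variable {K : Matrix q q ℝ}

lemma isUnit_admmOp_add (h : IsConsensus P A E Sg) (hρ : 0 < ρ) (hQ : Q.PosSemidef)
    (hS : (Eᵀ * Q * E).PosDef) (hK : IsKernelProj P A K) : IsUnit (admmOp ρ P A Q + K) := by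
  rw [← Matrix.mulVec_injective_iff_isUnit]
  refine (injective_iff_map_eq_zero (Matrix.mulVecLin (admmOp ρ P A Q + K))).2 fun v hv => ?_
  simp only [Matrix.mulVecLin_apply] at hv
  have h1 : K *ᵥ v = 0 := by
    have := congrArg (K *ᵥ ·) hv
    simpa only [Matrix.mulVec_mulVec, mul_add, hK.mul_admmOp h.transpose_swap, hK.mul_self,
      zero_add, Matrix.mulVec_zero] using this
  rw [Matrix.add_mulVec, h1, add_zero, admmOp_mulVec_eq_zero_iff h hρ hQ hS] at hv
  rw [← hK.apply_of_mem v hv.1 hv.2, h1]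

/-- Since kernel and range of the residual operator are fixed complementary subspaces, its
pseudo-inverse is a continuous function of the cost Hessian. -/
lemma isMoorePenrose_admmOp (h : IsConsensus P A E Sg) (hρ : 0 < ρ) (hQ : Q.PosSemidef)
    (hS : (Eᵀ * Q * E).PosDef) (hK : IsKernelProj P A K) :
    admmOp ρ P A Q * ((admmOp ρ P A Q + K)⁻¹ - K) = 1 - K ∧
    IsMoorePenrose (admmOp ρ P A Q) ((admmOp ρ P A Q + K)⁻¹ - K) := by
  have hu := (Matrix.isUnit_iff_isUnit_det _).mp (isUnit_admmOp_add h hρ hQ hS hK)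
  have a1 := hK.admmOp_mul (ρ := ρ) (Q := Q)
  have a2 := hK.mul_admmOp h.transpose_swap (ρ := ρ) (Q := Q)
  have a3 := hK.mul_self
  set F := admmOp ρ P A Q
  have b1 : K * (F + K)⁻¹ = K := by
    have : K * (F + K) = K := by rw [mul_add, a2, a3, zero_add]
    calc K * (F + K)⁻¹ = K * (F + K) * (F + K)⁻¹ := by rw [this]
      _ = K := by rw [mul_assoc, Matrix.mul_nonsing_inv _ hu, mul_one]
  have b2 : (F + K)⁻¹ * K = K := by
    have : (F + K) * K = K := by rw [add_mul, a1, a3, zero_add]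
    calc (F + K)⁻¹ * K = (F + K)⁻¹ * ((F + K) * K) := by rw [this]
      _ = K := by rw [← mul_assoc, Matrix.nonsing_inv_mul _ hu, one_mul]
  have c1 : F * ((F + K)⁻¹ - K) = 1 - K := by
    have : F * (F + K)⁻¹ = 1 - K := by
      rw [eq_sub_iff_add_eq]
      nth_rewrite 2 [← b1]
      rw [← add_mul, Matrix.mul_nonsing_inv _ hu]
    rw [mul_sub, this, a1, sub_zero]
  have c2 : ((F + K)⁻¹ - K) * F = 1 - K := by
    have : (F + K)⁻¹ * F = 1 - K := by
      rw [eq_sub_iff_add_eq]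
      nth_rewrite 2 [← b2]
      rw [← mul_add, Matrix.nonsing_inv_mul _ hu]
    rw [sub_mul, this, a2, sub_zero]
  refine ⟨c1, ?_, ?_, ?_, ?_⟩
  · rw [c1, sub_mul, a2, one_mul, sub_zero]
  · rw [c2, sub_mul, one_mul, mul_sub, b1, a3]; simp
  · rw [c1, Matrix.transpose_sub, Matrix.transpose_one, hK.transpose_eq]
  · rw [c2, Matrix.transpose_sub, Matrix.transpose_one, hK.transpose_eq]

lemma exists_equilibrium (h : IsConsensus P A E Sg) (hρ : 0 < ρ) (hQ : Q.PosSemidef)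
    (hS : (Eᵀ * Q * E).PosDef) (b : p → ℝ) :
    ∃ v, admmOp ρ P A Q *ᵥ v = (2 * ρ) • ((P * A * (admmHess ρ A Q)⁻¹) *ᵥ b) := by
  obtain ⟨K, hK⟩ := exists_isKernelProj P A
  set c := (2 * ρ) • ((P * A * (admmHess ρ A Q)⁻¹) *ᵥ b) with hc
  have hKc : K *ᵥ c = 0 := by
    rw [hc, Matrix.mulVec_smul, Matrix.mulVec_mulVec, ← Matrix.mul_assoc, ← Matrix.mul_assoc,
      hK.mul_swap h.transpose_swap, Matrix.neg_mul, hK.mul_right]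
    simp
  refine ⟨((admmOp ρ P A Q + K)⁻¹ - K) *ᵥ c, ?_⟩
  rw [Matrix.mulVec_mulVec, (isMoorePenrose_admmOp h hρ hQ hS hK).1, Matrix.sub_mulVec,
    Matrix.one_mulVec, hKc, sub_zero]

/-- `1 - F` is nonexpansive, being the swap composed with a reflected resolvent. -/
lemma norm_sub_admmOp_le (h : IsConsensus P A E Sg) (hρ : 0 < ρ) (hQ : Q.PosSemidef)
    (hS : (Eᵀ * Q * E).PosDef) (v : q → ℝ) :
    ‖euc (v - admmOp ρ P A Q *ᵥ v)‖ ^ 2 ≤ ‖euc v‖ ^ 2 := by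
  set w := (admmHess ρ A Q)⁻¹ *ᵥ (Aᵀ *ᵥ v) with hw
  have hu := isUnit_det_admmHess h hρ hQ hS
  have h4 : admmHess ρ A Q *ᵥ w = Aᵀ *ᵥ v := by
    rw [hw, Matrix.mulVec_mulVec, Matrix.mul_nonsing_inv _ hu, Matrix.one_mulVec]
  have h5 : v ⬝ᵥ (A *ᵥ w) = ρ * ((A *ᵥ w) ⬝ᵥ (A *ᵥ w)) + w ⬝ᵥ (Q *ᵥ w) := by
    rw [dotProduct_mulVec_transpose, ← h4, quadForm_admmHess, norm_euc_sq]
  have h6 : v - admmOp ρ P A Q *ᵥ v = P *ᵥ ((2 * ρ) • (A *ᵥ w) - v) := by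
    simp only [admmOp, Matrix.sub_mulVec, Matrix.add_mulVec, Matrix.one_mulVec, Matrix.smul_mulVec,
      ← Matrix.mulVec_mulVec, Matrix.mulVec_sub, Matrix.mulVec_smul, ← hw]
    abel
  have hPP : ∀ u, (P *ᵥ u) ⬝ᵥ (P *ᵥ u) = u ⬝ᵥ u := fun u => by
    rw [dotProduct_mulVec_transpose, h.transpose_swap, Matrix.mulVec_mulVec, h.swap_mul_swap,
      Matrix.one_mulVec]
  rw [norm_euc_sq, norm_euc_sq, h6, hPP]
  have h7 := (posSemidef_iff_real.mp hQ).2 w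
  have h8 := dotProduct_comm v (A *ᵥ w)
  simp only [sub_dotProduct, dotProduct_sub, smul_dotProduct, dotProduct_smul, smul_eq_mul]
  nlinarith

/-- One relaxed ADMM iteration contracts the distance to the equilibria. -/
lemma infDist_relaxed_le (h : IsConsensus P A E Sg) (hρ : 0 < ρ) (hQ : Q.PosSemidef)
    (hS : (Eᵀ * Q * E).PosDef) {B : Matrix q q ℝ} (hB : IsMoorePenrose (admmOp ρ P A Q) B)
    {f α σ : ℝ} (hf : 0 < f) (hBf : ‖B‖ ≤ f) (hα : 0 < α) (hα1 : α < 1) (hσ : f / α ≤ σ)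
    {c : q → ℝ} (hc : ∃ v, admmOp ρ P A Q *ᵥ v = c) (v : q → ℝ) :
    Metric.infDist (euc (v - α • (admmOp ρ P A Q *ᵥ v) + α • c)) (solSet (admmOp ρ P A Q) c) ≤
      √(1 - (1 - α) / (α * σ ^ 2)) *
        Metric.infDist (euc v) (solSet (admmOp ρ P A Q) c) := by
  set F := admmOp ρ P A Q with hF
  rw [infDist_solSet hB hc v]
  set w := B *ᵥ (F *ᵥ v - c) with hw
  have hmem := sub_pinv_mem_solSet hB hc v
  have hFw : F *ᵥ w = F *ᵥ v - c := by
    have h1 : F *ᵥ (v - w) = c := hmem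
    rw [Matrix.mulVec_sub] at h1
    rw [← h1]; abel
  refine (Metric.infDist_le_dist_of_mem hmem).trans ?_
  rw [dist_eq_norm, ← WithLp.toLp_sub]
  have e1 : v - α • F *ᵥ v + α • c - (v - w) = w - α • (F *ᵥ w) := by
    rw [hFw, smul_sub]; abel
  rw [e1]
  have hne : ‖euc (w - F *ᵥ w)‖ ^ 2 ≤ ‖euc w‖ ^ 2 := norm_sub_admmOp_le h hρ hQ hS w
  have hbd : ‖euc w‖ ≤ f * ‖euc (F *ᵥ w)‖ := by
    rw [hFw]
    exact (norm_euc_mulVec_le _ _).trans (by gcongr)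
  have hfs : f ≤ α * σ := by rwa [div_le_iff₀' hα] at hσ
  have hσ0 : 0 < σ := pos_of_mul_pos_right (hf.trans_le hfs) hα.le
  have hbd2 : ‖euc w‖ ^ 2 ≤ (α * σ) ^ 2 * ‖euc (F *ᵥ w)‖ ^ 2 := by
    rw [← mul_pow]
    gcongr
    exact hbd.trans (by gcongr)
  have key : ‖euc (w - α • (F *ᵥ w))‖ ^ 2 ≤ (1 - (1 - α) / (α * σ ^ 2)) * ‖euc w‖ ^ 2 := by
    have hdiv : (1 - α) / (α * σ ^ 2) * ‖euc w‖ ^ 2 ≤ α * (1 - α) * ‖euc (F *ᵥ w)‖ ^ 2 := by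
      rw [div_mul_eq_mul_div, div_le_iff₀ (by positivity)]
      have h1α : 0 ≤ 1 - α := by linarith
      calc (1 - α) * ‖euc w‖ ^ 2 ≤ (1 - α) * ((α * σ) ^ 2 * ‖euc (F *ᵥ w)‖ ^ 2) := by gcongr
        _ = _ := by ring
    have hexp : ‖euc (w - α • (F *ᵥ w))‖ ^ 2 ≤
        ‖euc w‖ ^ 2 - α * (1 - α) * ‖euc (F *ᵥ w)‖ ^ 2 := by
      simp only [norm_euc_sq, sub_dotProduct, dotProduct_sub, smul_dotProduct, dotProduct_smul,
        smul_eq_mul] at hne ⊢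
      have := dotProduct_comm w (F *ᵥ w)
      nlinarith
    linarith
  calc ‖euc (w - α • (F *ᵥ w))‖ = √(‖euc (w - α • (F *ᵥ w))‖ ^ 2) :=
        (Real.sqrt_sq (norm_nonneg _)).symm
    _ ≤ √((1 - (1 - α) / (α * σ ^ 2)) * ‖euc w‖ ^ 2) := Real.sqrt_le_sqrt key
    _ = _ := by rw [Real.sqrt_mul' _ (by positivity), Real.sqrt_sq (norm_nonneg _)]

end Admm

end DistObs

namespace DistObs

/-! ### Selection matrices and the consensus structure of the communication graph -/

section Selection

lemma select_mulVec {m n : Type*} [Fintype n] [DecidableEq n] (f : m → n) (v : n → ℝ) :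
    (Matrix.of fun r c => if c = f r then (1 : ℝ) else 0) *ᵥ v = v ∘ f := by
  funext r
  simp [Matrix.mulVec, dotProduct]

lemma matrix_ext_bilin {m n : Type*} [Fintype m] [Fintype n] {M N : Matrix m n ℝ}
    (h : ∀ v w, v ⬝ᵥ (M *ᵥ w) = v ⬝ᵥ (N *ᵥ w)) : M = N := by
  classical
  ext i j
  simpa using h (Pi.single i 1) (Pi.single j 1)

lemma dotProduct_mul_mul_transpose {m n : Type*} [Fintype m] [Fintype n]
    (A : Matrix n m ℝ) (M : Matrix m m ℝ) (v w : n → ℝ) :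
    v ⬝ᵥ ((A * M * Aᵀ) *ᵥ w) = (Aᵀ *ᵥ v) ⬝ᵥ (M *ᵥ (Aᵀ *ᵥ w)) := by
  rw [← Matrix.mulVec_mulVec, ← Matrix.mulVec_mulVec, dotProduct_mulVec_transpose, dotProduct_comm]

lemma dotProduct_transpose_mul_mul {m n : Type*} [Fintype m] [Fintype n]
    (A : Matrix m n ℝ) (M : Matrix m m ℝ) (v w : n → ℝ) :
    v ⬝ᵥ ((Aᵀ * M * A) *ᵥ w) = (A *ᵥ v) ⬝ᵥ (M *ᵥ (A *ᵥ w)) := by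
  simpa using dotProduct_mul_mul_transpose Aᵀ M v w

variable {ι : Type*} [Fintype ι] [DecidableEq ι] {d : ℕ}

lemma blockSel_transpose_mulVec (p : ι) (v : ι × Fin d → ℝ) :
    (blockSel d p)ᵀ *ᵥ v = block v p := by
  have : (blockSel d p)ᵀ = Matrix.of fun (a : Fin d) (r : ι × Fin d) =>
      if r = (p, a) then (1 : ℝ) else 0 := rfl
  rw [this, select_mulVec]
  rfl

lemma pairSel_transpose_mulVec (p p' : ι) (v : ι × Fin d → ℝ) :
    (pairSel d p p')ᵀ *ᵥ v = Sum.elim (block v p) (block v p') := by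
  rw [pairSel, Matrix.transpose_fromCols, Matrix.fromRows_mulVec, blockSel_transpose_mulVec,
    blockSel_transpose_mulVec]

lemma blockSel_transpose_mul_self (p : ι) : (blockSel d p)ᵀ * blockSel d p = 1 := by
  ext a b
  simp [Matrix.mul_apply, blockSel, Matrix.one_apply, eq_comm]

lemma pairSel_transpose_mul_self {p p' : ι} (h : p ≠ p') :
    (pairSel d p p')ᵀ * pairSel d p p' = 1 := by
  have h0 : ∀ {r s : ι}, r ≠ s → (blockSel d r)ᵀ * blockSel d s = 0 := by
    intro r s hrs
    ext a b
    simp [Matrix.mul_apply, blockSel, hrs.symm]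
  rw [pairSel, Matrix.transpose_fromCols, Matrix.fromRows_mul_fromCols,
    blockSel_transpose_mul_self, blockSel_transpose_mul_self, h0 h, h0 h.symm,
    Matrix.fromBlocks_one]

end Selection

variable {V : Type*} [Fintype V] [DecidableEq V] {G : SimpleGraph V} {d m ql qr : ℕ}

omit [Fintype V] [DecidableEq V] in
lemma dualSwap_dualSwap (s : G.Dart ⊕ G.Dart) : dualSwap (dualSwap s) = s := by
  cases s <;> simp [dualSwap]

/-- The agent whose variable a primal copy represents. -/
def copyOf : V ⊕ G.Dart → V
  | Sum.inl i => i
  | Sum.inr e => e.snd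

omit [Fintype V] [DecidableEq V] in
lemma copyOf_dualVar_dualSwap (s : G.Dart ⊕ G.Dart) :
    copyOf (dualVar (dualSwap s)) = copyOf (dualVar s) := by
  cases s <;> rfl

/-- The matrix distributing a global vector to all its holders. -/
def copyE (G : SimpleGraph V) (d : ℕ) : Matrix (PrimalIdx G d) (V × Fin d) ℝ :=
  Matrix.of fun r c => if c = (copyOf r.1, r.2) then 1 else 0

lemma copyE_mulVec (x : V × Fin d → ℝ) :
    copyE G d *ᵥ x = fun r => x (copyOf r.1, r.2) :=
  select_mulVec _ x

section Graph

variable [DecidableRel G.Adj]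

lemma permP_mulVec (v : DualIdx G d → ℝ) : permP G d *ᵥ v = fun r => v (dualSwap r.1, r.2) :=
  select_mulVec _ v

lemma matAq_mulVec (z : PrimalIdx G d → ℝ) : matAq G d *ᵥ z = fun r => z (dualVar r.1, r.2) :=
  select_mulVec _ z

lemma matSigma_mulVec (z : PrimalIdx G d → ℝ) :
    matSigma G d *ᵥ z = fun r => z (Sum.inl r.1, r.2) :=
  select_mulVec _ z

lemma isConsensus (G : SimpleGraph V) [DecidableRel G.Adj] (d : ℕ) :
    IsConsensus (permP G d) (matAq G d) (copyE G d) (matSigma G d) where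
  transpose_swap := by
    ext r c
    simp only [permP, Matrix.transpose_apply, Matrix.of_apply]
    congr 1
    rw [eq_iff_iff]
    constructor <;> rintro rfl <;> simp [dualSwap_dualSwap]
  swap_mul_swap := by
    refine Matrix.mulVec_injective (funext fun v => ?_)
    rw [← Matrix.mulVec_mulVec, permP_mulVec, permP_mulVec, Matrix.one_mulVec]
    simp [dualSwap_dualSwap]
  swap_copies := by
    refine Matrix.mulVec_injective (funext fun v => ?_)
    simp only [← Matrix.mulVec_mulVec, permP_mulVec, matAq_mulVec, copyE_mulVec,
      copyOf_dualVar_dualSwap]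
  eq_copies := by
    intro z hz
    rw [permP_mulVec, matAq_mulVec] at hz
    rw [copyE_mulVec, matSigma_mulVec]
    funext ⟨r, a⟩
    cases r with
    | inl i => rfl
    | inr e => exact congrFun hz (Sum.inr e, a)

lemma matAq_transpose_mul_self :
    (matAq G d)ᵀ * matAq G d = Matrix.diagonal (fun r : PrimalIdx G d =>
      match r.1 with
      | Sum.inl i => (G.degree i : ℝ)
      | Sum.inr _ => 1) := by
  ext ⟨r, a⟩ ⟨s, b⟩
  simp only [Matrix.mul_apply, Matrix.transpose_apply, matAq, Matrix.of_apply, ite_mul, one_mul,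
    zero_mul, Matrix.diagonal_apply]
  rw [Fintype.sum_prod_type_right]
  by_cases hab : (r, a) = (s, b)
  · obtain ⟨rfl, rfl⟩ := Prod.mk.inj hab
    simp only [Prod.mk.injEq, if_true]
    rw [Finset.sum_eq_single a (fun c _ hc => by simp [hc.symm]) (by simp)]
    rw [Fintype.sum_sum_type]
    cases r with
    | inl i =>
      have := G.dart_fst_fiber_card_eq_degree i
      simp only [dualVar, Sum.inl.injEq, and_true, reduceCtorEq, if_false, Finset.sum_const_zero,
        add_zero, ← this]
      rw [Finset.card_filter]
      push_cast
      refine Finset.sum_congr rfl fun e _ => ?_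
      by_cases h : e.fst = i <;> simp [h, Ne.symm]
    | inr e =>
      simp [dualVar]
  · rw [if_neg hab]
    refine Finset.sum_eq_zero fun c _ => Finset.sum_eq_zero fun t _ => ?_
    by_cases h : (r, a) = (dualVar t, c)
    · rw [if_pos h, if_neg]
      intro h'
      exact hab (h.trans h'.symm)
    · rw [if_neg h]

/-- Assembly of local and pairwise contributions into a matrix acting on the primal copies. -/
noncomputable def assembleCopies (Sl : V → Matrix (Fin d) (Fin d) ℝ)
    (Se : G.Dart → Matrix (Fin d ⊕ Fin d) (Fin d ⊕ Fin d) ℝ) :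
    Matrix (PrimalIdx G d) (PrimalIdx G d) ℝ :=
  (∑ i : V, selOwn G d i * Sl i * (selOwn G d i)ᵀ) +
  (1 / 2 : ℝ) • ∑ e : G.Dart, selEdge d e * Se e * (selEdge d e)ᵀ

/-- Assembly of local and pairwise contributions into a global matrix. -/
noncomputable def assembleGlobal (Sl : V → Matrix (Fin d) (Fin d) ℝ)
    (Se : G.Dart → Matrix (Fin d ⊕ Fin d) (Fin d ⊕ Fin d) ℝ) :
    Matrix (V × Fin d) (V × Fin d) ℝ :=
  (∑ i : V, blockSel d i * Sl i * (blockSel d i)ᵀ) +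
  (1 / 2 : ℝ) • ∑ e : G.Dart, pairSel d e.fst e.snd * Se e * (pairSel d e.fst e.snd)ᵀ

lemma selOwn_transpose_mul_copyE (i : V) : (selOwn G d i)ᵀ * copyE G d = (blockSel d i)ᵀ := by
  refine Matrix.mulVec_injective (funext fun v => ?_)
  rw [← Matrix.mulVec_mulVec, selOwn, blockSel_transpose_mulVec, blockSel_transpose_mulVec,
    copyE_mulVec]
  rfl

lemma selEdge_transpose_mul_copyE (e : G.Dart) :
    (selEdge d e)ᵀ * copyE G d = (pairSel d e.fst e.snd)ᵀ := by
  refine Matrix.mulVec_injective (funext fun v => ?_)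
  rw [← Matrix.mulVec_mulVec, selEdge, pairSel_transpose_mulVec, pairSel_transpose_mulVec,
    copyE_mulVec]
  rfl

variable (Sl Sl' : V → Matrix (Fin d) (Fin d) ℝ)
  (Se Se' : G.Dart → Matrix (Fin d ⊕ Fin d) (Fin d ⊕ Fin d) ℝ)

lemma assembleCopies_mul_copyE :
    assembleCopies Sl Se * copyE G d = (∑ i : V, selOwn G d i * Sl i * (blockSel d i)ᵀ) +
      (1 / 2 : ℝ) • ∑ e : G.Dart, selEdge d e * Se e * (pairSel d e.fst e.snd)ᵀ := by
  simp only [assembleCopies, Matrix.add_mul, Matrix.smul_mul, Matrix.sum_mul, Matrix.mul_assoc,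
    selOwn_transpose_mul_copyE, selEdge_transpose_mul_copyE]

lemma copyE_transpose_mul_assembleCopies_mul :
    (copyE G d)ᵀ * assembleCopies Sl Se * copyE G d = assembleGlobal Sl Se := by
  have h1 : ∀ i, (copyE G d)ᵀ * selOwn G d i = blockSel d i := fun i => by
    simpa using congrArg Matrix.transpose (selOwn_transpose_mul_copyE (G := G) (d := d) i)
  have h2 : ∀ e : G.Dart, (copyE G d)ᵀ * selEdge d e = pairSel d e.fst e.snd := fun e => by
    simpa using congrArg Matrix.transpose (selEdge_transpose_mul_copyE (d := d) e)
  simp only [Matrix.mul_assoc, assembleCopies_mul_copyE, assembleGlobal, Matrix.mul_add,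
    Matrix.mul_smul, Matrix.mul_sum]
  simp only [← Matrix.mul_assoc, h1, h2]

lemma assembleCopies_add_smul (t : ℝ) :
    assembleCopies (fun i => Sl i + t • Sl' i) (fun e => Se e + t • Se' e) =
      assembleCopies Sl Se + t • assembleCopies Sl' Se' := by
  simp only [assembleCopies, Matrix.mul_add, Matrix.add_mul, Matrix.mul_smul, Matrix.smul_mul,
    Finset.sum_add_distrib, smul_add, Finset.smul_sum, smul_comm t (1 / 2 : ℝ)]
  abel

lemma bilin_assembleGlobal (v w : V × Fin d → ℝ) :
    v ⬝ᵥ (assembleGlobal Sl Se *ᵥ w) = (∑ i, block v i ⬝ᵥ (Sl i *ᵥ block w i)) +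
      (1 / 2 : ℝ) * ∑ e : G.Dart, Sum.elim (block v e.fst) (block v e.snd) ⬝ᵥ
        (Se e *ᵥ Sum.elim (block w e.fst) (block w e.snd)) := by
  simp only [assembleGlobal, Matrix.add_mulVec, dotProduct_add, Matrix.smul_mulVec,
    dotProduct_smul, Matrix.sum_mulVec, dotProduct_sum, dotProduct_mul_mul_transpose,
    blockSel_transpose_mulVec, pairSel_transpose_mulVec, smul_eq_mul]

lemma bilin_assembleCopies (v w : PrimalIdx G d → ℝ) :
    v ⬝ᵥ (assembleCopies Sl Se *ᵥ w) =
      (∑ i, block v (Sum.inl i) ⬝ᵥ (Sl i *ᵥ block w (Sum.inl i))) +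
      (1 / 2 : ℝ) * ∑ e : G.Dart, Sum.elim (block v (Sum.inl e.fst)) (block v (Sum.inr e)) ⬝ᵥ
        (Se e *ᵥ Sum.elim (block w (Sum.inl e.fst)) (block w (Sum.inr e))) := by
  simp only [assembleCopies, Matrix.add_mulVec, dotProduct_add, Matrix.smul_mulVec,
    dotProduct_smul, Matrix.sum_mulVec, dotProduct_sum, dotProduct_mul_mul_transpose,
    selOwn, selEdge, blockSel_transpose_mulVec, pairSel_transpose_mulVec, smul_eq_mul]

variable {Sl Sl' Se Se'}

lemma posSemidef_assembleCopies (hl : ∀ i, (Sl i).PosSemidef) (he : ∀ e, (Se e).PosSemidef) :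
    (assembleCopies Sl Se).PosSemidef := by
  refine Matrix.PosSemidef.add ?_ (Matrix.PosSemidef.smul ?_ (by norm_num))
  · exact Matrix.posSemidef_sum _ fun i _ => posSemidef_congruence' (hl i) _
  · exact Matrix.posSemidef_sum _ fun e _ => posSemidef_congruence' (he e) _

end Graph

/-! ### The stacked network matrices in terms of their blocks -/

namespace Network

variable (net : Network G d m ql qr) (k : ℕ)

lemma block_bigA_mulVec (x : V × Fin d → ℝ) (i : V) :
    block (net.bigA k *ᵥ x) i = net.A k i *ᵥ block x i := by
  funext a
  simp [block, Matrix.mulVec, dotProduct, bigA, Fintype.sum_prod_type, ite_mul]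

lemma blockSel_transpose_mul_bigA (i : V) :
    (blockSel d i)ᵀ * net.bigA k = net.A k i * (blockSel d i)ᵀ := by
  refine Matrix.mulVec_injective (funext fun x => ?_)
  rw [← Matrix.mulVec_mulVec, ← Matrix.mulVec_mulVec, blockSel_transpose_mulVec,
    blockSel_transpose_mulVec, block_bigA_mulVec]

variable {net k}

lemma isUnit_det_A (h : IsUnit (net.bigA k)) (i : V) : IsUnit (net.A k i).det := by
  have hu := (Matrix.isUnit_iff_isUnit_det _).mp h
  have : net.A k i * ((blockSel d i)ᵀ * (net.bigA k)⁻¹ * blockSel d i) = 1 := by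
    rw [← Matrix.mul_assoc, ← Matrix.mul_assoc, ← blockSel_transpose_mul_bigA, Matrix.mul_assoc _
      (net.bigA k), Matrix.mul_nonsing_inv _ hu, Matrix.mul_one, blockSel_transpose_mul_self]
  exact (Matrix.isUnit_iff_isUnit_det _).mp
    (IsUnit.of_mul_eq_one _ this)

lemma blockSel_transpose_mul_bigA_inv (h : IsUnit (net.bigA k)) (i : V) :
    (blockSel d i)ᵀ * (net.bigA k)⁻¹ = (net.A k i)⁻¹ * (blockSel d i)ᵀ := by
  have hu := (Matrix.isUnit_iff_isUnit_det _).mp h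
  have hi := isUnit_det_A h i
  calc (blockSel d i)ᵀ * (net.bigA k)⁻¹
      = (net.A k i)⁻¹ * (net.A k i * (blockSel d i)ᵀ) * (net.bigA k)⁻¹ := by
        rw [← Matrix.mul_assoc, Matrix.nonsing_inv_mul _ hi, Matrix.one_mul]
    _ = (net.A k i)⁻¹ * (blockSel d i)ᵀ := by
        rw [← blockSel_transpose_mul_bigA, Matrix.mul_assoc, Matrix.mul_assoc,
          Matrix.mul_nonsing_inv _ hu, Matrix.mul_one]

lemma pairSel_transpose_mul_bigA_inv (h : IsUnit (net.bigA k)) (e : G.Dart) :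
    (pairSel d e.fst e.snd)ᵀ * (net.bigA k)⁻¹ =
      (Observer.pairA net k e)⁻¹ * (pairSel d e.fst e.snd)ᵀ := by
  have h1 := isUnit_det_A h e.fst
  have h2 := isUnit_det_A h e.snd
  have hinv : (Observer.pairA net k e)⁻¹ =
      Matrix.fromBlocks (net.A k e.fst)⁻¹ 0 0 (net.A k e.snd)⁻¹ := by
    refine Matrix.inv_eq_right_inv ?_
    rw [Observer.pairA, Matrix.fromBlocks_multiply]
    simp [Matrix.mul_nonsing_inv _ h1, Matrix.mul_nonsing_inv _ h2]
  rw [hinv, pairSel, Matrix.transpose_fromCols, Matrix.fromRows_mul, Matrix.fromBlocks_mul_fromRows,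
    blockSel_transpose_mul_bigA_inv h, blockSel_transpose_mul_bigA_inv h]
  simp

variable (net k)

lemma bigH_mulVec (x : V × Fin d → ℝ) :
    net.bigH k *ᵥ x = Sum.elim (fun r => net.yl k x r.1.1 r.2)
      (fun r => net.yr k x r.1.1.1 r.1.1.2 r.2) := by
  funext r
  rcases r with ⟨i, a⟩ | ⟨e, a⟩
  · simp [Matrix.mulVec, dotProduct, bigH, yl, block, Fintype.sum_prod_type, ite_mul]
  · simp [Matrix.mulVec, dotProduct, bigH, yr, block, Fintype.sum_prod_type, ite_mul, add_mul,
      Finset.sum_add_distrib]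

omit [Fintype V] [DecidableEq V] in
lemma Hfwd_mulVec (e : G.Dart) (x : V × Fin d → ℝ) :
    net.Hfwd k e *ᵥ Sum.elim (block x e.fst) (block x e.snd) = net.yr k x e.fst e.snd := by
  rw [Hfwd, Matrix.fromCols_mulVec, yr]
  simp

omit [Fintype V] [DecidableEq V] in
lemma Hbwd_mulVec (e : G.Dart) (x : V × Fin d → ℝ) :
    net.Hbwd k e *ᵥ Sum.elim (block x e.fst) (block x e.snd) = net.yr k x e.snd e.fst := by
  rw [Hbwd, Matrix.fromCols_mulVec, yr]
  simp [add_comm]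

end Network

/-! ### Distributed and global information -/

namespace Observer

variable (net : Network G d m ql qr) (obs : Observer G d ql qr) (k : ℕ)

omit [Fintype V] in
lemma bilin_bigR (v w : net.MeasIdx → ℝ) :
    v ⬝ᵥ (obs.bigR net k *ᵥ w) =
      (∑ i : {i : V // i ∈ net.Vl}, (fun a => v (Sum.inl (i, a))) ⬝ᵥ
        (obs.Rl k i *ᵥ fun a => w (Sum.inl (i, a)))) +
      ∑ e : {e : V × V // e ∈ net.Es}, (fun a => v (Sum.inr (e, a))) ⬝ᵥ
        (obs.Rr k e.1.1 e.1.2 *ᵥ fun a => w (Sum.inr (e, a))) := by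
  simp [Matrix.mulVec, dotProduct, bigR, Fintype.sum_sum_type, Fintype.sum_prod_type, ite_mul]

variable [DecidableRel G.Adj]

/-- Stacking the measurements and summing the information contributions of agents and edges give
the same matrix: each sensing edge is seen by exactly two darts, each with weight one half. -/
lemma bigH_bigR_bigH_eq :
    (net.bigH k)ᵀ * obs.bigR net k * net.bigH k =
      assembleGlobal (obs.Jl net k) (obs.Je net k) := by
  refine matrix_ext_bilin fun v w => ?_
  rw [dotProduct_transpose_mul_mul, bilin_bigR, bilin_assembleGlobal, net.bigH_mulVec,
    net.bigH_mulVec]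
  congr 1
  · simp only [Sum.elim_inl]
    rw [← Finset.sum_subtype net.Vl (p := fun i => i ∈ net.Vl) (fun _ => Iff.rfl)
      (fun i => net.yl k v i ⬝ᵥ (obs.Rl k i *ᵥ net.yl k w i)), ← Finset.sum_filter_add_sum_filter_not
      Finset.univ (· ∈ net.Vl)]
    rw [Finset.sum_eq_zero (s := Finset.univ.filter (· ∉ net.Vl)), add_zero]
    · refine Finset.sum_congr (by ext; simp) fun i hi => ?_
      rw [Jl, if_pos (by simpa using hi), dotProduct_transpose_mul_mul]
      rfl
    · intro i hi
      rw [Jl, if_neg (by simpa using hi)]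
      simp
  · simp only [Sum.elim_inr]
    set g : V × V → ℝ := fun e =>
      net.yr k v e.1 e.2 ⬝ᵥ (obs.Rr k e.1 e.2 *ᵥ net.yr k w e.1 e.2) with hg
    rw [← Finset.sum_subtype net.Es (p := fun i => i ∈ net.Es) (fun _ => Iff.rfl) g]
    have hJe : ∀ e : G.Dart, Sum.elim (block v e.fst) (block v e.snd) ⬝ᵥ
        (obs.Je net k e *ᵥ Sum.elim (block w e.fst) (block w e.snd)) =
        (if (e.fst, e.snd) ∈ net.Es then g (e.fst, e.snd) else 0) +
        (if (e.symm.fst, e.symm.snd) ∈ net.Es then g (e.symm.fst, e.symm.snd) else 0) := by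
      intro e
      rw [Je, Matrix.add_mulVec, dotProduct_add]
      congr 1
      · split_ifs
        · rw [dotProduct_transpose_mul_mul, net.Hfwd_mulVec, net.Hfwd_mulVec]
        · simp
      · change _ = if (e.snd, e.fst) ∈ net.Es then g (e.snd, e.fst) else 0
        split_ifs
        · rw [dotProduct_transpose_mul_mul, net.Hbwd_mulVec, net.Hbwd_mulVec]
        · simp
    simp only [hJe, Finset.sum_add_distrib]
    have hsymm : ∑ e : G.Dart,
        (if (e.symm.fst, e.symm.snd) ∈ net.Es then g (e.symm.fst, e.symm.snd) else 0) =
        ∑ e : G.Dart, if (e.fst, e.snd) ∈ net.Es then g (e.fst, e.snd) else 0 :=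
      Equiv.sum_comp (Function.Involutive.toPerm _ SimpleGraph.Dart.symm_involutive)
        (fun e : G.Dart => if (e.fst, e.snd) ∈ net.Es then g (e.fst, e.snd) else 0)
    rw [hsymm, ← two_mul, ← mul_assoc, one_div, inv_mul_cancel₀ two_ne_zero, one_mul,
      ← Finset.sum_filter]
    symm
    refine Finset.sum_bij (fun (e : G.Dart) _ => (e.fst, e.snd)) ?_ ?_ ?_ ?_
    · intro e he
      simpa using he
    · intro e _ f _ hef
      exact SimpleGraph.Dart.ext _ _ hef
    · intro e he
      exact ⟨⟨e, net.sensing_adj e.1 e.2 he⟩, by simpa using he, rfl⟩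
    · intro e _
      rfl

omit [Fintype V] [DecidableRel G.Adj] in
lemma SlPost_def : obs.SlPost net k = fun i => obs.SlPrior net k i + obs.ε • obs.Jl net k i := rfl

omit [Fintype V] [DecidableRel G.Adj] in
lemma SePost_def : obs.SePost net k = fun e => obs.SePrior net k e + obs.ε • obs.Je net k e := rfl

/-- Prior cost Hessian on the copies. -/
noncomputable def hessPrior : Matrix (PrimalIdx G d) (PrimalIdx G d) ℝ :=
  assembleCopies (obs.SlPrior net k) (obs.SePrior net k)

/-- Posterior cost Hessian `∇² ∑ᵢ Jᵢ` on the copies. -/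
noncomputable def hessPost : Matrix (PrimalIdx G d) (PrimalIdx G d) ℝ :=
  assembleCopies (obs.SlPost net k) (obs.SePost net k)

/-- Information of the current measurements on the copies. -/
noncomputable def hessMeas : Matrix (PrimalIdx G d) (PrimalIdx G d) ℝ :=
  assembleCopies (obs.Jl net k) (obs.Je net k)

lemma hessPost_eq : obs.hessPost net k = obs.hessPrior net k + obs.ε • obs.hessMeas net k := by
  rw [hessPost, SlPost_def, SePost_def, assembleCopies_add_smul]
  rfl

lemma hessMeas_global :
    (copyE G d)ᵀ * obs.hessMeas net k * copyE G d =
      (net.bigH k)ᵀ * obs.bigR net k * net.bigH k := by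
  rw [hessMeas, copyE_transpose_mul_assembleCopies_mul, bigH_bigR_bigH_eq]

lemma assembleGlobal_predict {net : Network G d m ql qr} {k : ℕ} (h : IsUnit (net.bigA k)) (t : ℝ)
    (Sl : V → Matrix (Fin d) (Fin d) ℝ)
    (Se : G.Dart → Matrix (Fin d ⊕ Fin d) (Fin d ⊕ Fin d) ℝ) :
    t • (((net.bigA k)⁻¹)ᵀ * assembleGlobal Sl Se * (net.bigA k)⁻¹) =
      assembleGlobal (fun i => t • (((net.A k i)⁻¹)ᵀ * Sl i * (net.A k i)⁻¹))
        (fun e => t • (((pairA net k e)⁻¹)ᵀ * Se e * (pairA net k e)⁻¹)) := by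
  have h1 := fun i => Network.blockSel_transpose_mul_bigA_inv h i
  have h2 := fun e : G.Dart => Network.pairSel_transpose_mul_bigA_inv h e
  have h1' : ∀ i, ((net.bigA k)⁻¹)ᵀ * blockSel d i = blockSel d i * ((net.A k i)⁻¹)ᵀ := fun i => by
    simpa only [Matrix.transpose_mul, Matrix.transpose_transpose] using
      congrArg Matrix.transpose (h1 i)
  have h2' : ∀ e : G.Dart, ((net.bigA k)⁻¹)ᵀ * pairSel d e.fst e.snd =
      pairSel d e.fst e.snd * ((pairA net k e)⁻¹)ᵀ := fun e => by
    simpa only [Matrix.transpose_mul, Matrix.transpose_transpose] using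
      congrArg Matrix.transpose (h2 e)
  simp only [assembleGlobal, Matrix.add_mul, Matrix.mul_add, Matrix.mul_smul, Matrix.smul_mul,
    Matrix.mul_sum, Matrix.sum_mul, smul_add, Finset.smul_sum, smul_comm t (1 / 2 : ℝ),
    Matrix.mul_assoc, h1, h2]
  simp only [← Matrix.mul_assoc, h1', h2']

/-- The global prior information matrix is the sum of the distributed contributions. -/
lemma SPrior_eq (h : ∀ k, IsUnit (net.bigA k)) :
    obs.SPrior net k = assembleGlobal (obs.SlPrior net k) (obs.SePrior net k) := by
  induction k with
  | zero => rfl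
  | succ k ih =>
    have h1 : obs.SPrior net k + obs.ε • ((net.bigH k)ᵀ * obs.bigR net k * net.bigH k) =
        assembleGlobal (obs.SlPost net k) (obs.SePost net k) := by
      rw [ih, ← hessMeas_global, ← copyE_transpose_mul_assembleCopies_mul,
        ← copyE_transpose_mul_assembleCopies_mul]
      change _ = (copyE G d)ᵀ * obs.hessPost net k * copyE G d
      rw [hessPost_eq, Matrix.mul_add, Matrix.add_mul, Matrix.mul_smul, Matrix.smul_mul]
      rfl
    rw [SPrior, h1, assembleGlobal_predict (h k)]
    rfl

lemma hessPrior_global (h : ∀ k, IsUnit (net.bigA k)) :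
    (copyE G d)ᵀ * obs.hessPrior net k * copyE G d = obs.SPrior net k := by
  rw [hessPrior, copyE_transpose_mul_assembleCopies_mul, SPrior_eq _ _ _ h]

lemma hessPost_global (h : ∀ k, IsUnit (net.bigA k)) :
    (copyE G d)ᵀ * obs.hessPost net k * copyE G d = obs.SPost net k := by
  rw [hessPost_eq, Matrix.mul_add, Matrix.add_mul, Matrix.mul_smul, Matrix.smul_mul,
    hessPrior_global _ _ _ h, hessMeas_global]
  rfl

lemma Hrho_eq : obs.Hrho net k = admmHess obs.ρ (matAq G d) (obs.hessPost net k) := by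
  rw [admmHess, matAq_transpose_mul_self, Hrho, add_assoc]
  rfl

lemma matF_eq : obs.matF net k = admmOp obs.ρ (permP G d) (matAq G d) (obs.hessPost net k) := by
  rw [matF, Hrho_eq]
  rfl

lemma matM_eq : obs.matM net k = (2 * obs.ρ) • (permP G d * matAq G d *
    (admmHess obs.ρ (matAq G d) (obs.hessPost net k))⁻¹ * (obs.hessMeas net k * copyE G d)) := by
  rw [matM, Hrho_eq, hessMeas, assembleCopies_mul_copyE]

lemma bBar_eq (x xhat : V × Fin d → ℝ) :
    obs.bBar net k x xhat = (obs.hessMeas net k * copyE G d) *ᵥ (x - xhat) := by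
  have hb : ∀ i, block (x - xhat) i = block x i - block xhat i := fun i => rfl
  have hbl : ∀ i, obs.bl net k x xhat i = obs.Jl net k i *ᵥ ((blockSel d i)ᵀ *ᵥ (x - xhat)) := by
    intro i
    rw [blockSel_transpose_mulVec, hb, bl, Jl]
    split_ifs
    · simp only [Network.yl, ← Matrix.mulVec_sub, ← Matrix.mulVec_mulVec]
    · simp
  have hbe : ∀ e : G.Dart, obs.be net k x xhat e =
      obs.Je net k e *ᵥ ((pairSel d e.fst e.snd)ᵀ *ᵥ (x - xhat)) := by
    intro e
    have hs : Sum.elim (block (x - xhat) e.fst) (block (x - xhat) e.snd) =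
        Sum.elim (block x e.fst) (block x e.snd) - Sum.elim (block xhat e.fst) (block xhat e.snd) := by
      funext s
      cases s <;> rfl
    rw [pairSel_transpose_mulVec, hs, be, Je, Matrix.add_mulVec]
    congr 1
    · split_ifs
      · simp only [← net.Hfwd_mulVec k e x, ← Matrix.mulVec_sub, ← Matrix.mulVec_mulVec]
      · simp
    · split_ifs
      · simp only [← net.Hbwd_mulVec k e x, ← Matrix.mulVec_sub, ← Matrix.mulVec_mulVec]
      · simp
  rw [hessMeas, assembleCopies_mul_copyE, bBar]
  simp only [hbl, hbe, Matrix.add_mulVec, Matrix.smul_mulVec, Matrix.sum_mulVec,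
    ← Matrix.mulVec_mulVec]

lemma vecC_eq (x xhat : V × Fin d → ℝ) :
    obs.vecC net k x xhat = obs.matM net k *ᵥ (x - xhat) := by
  rw [vecC, matM_eq, bBar_eq, Hrho_eq, Matrix.smul_mulVec, Matrix.mulVec_mulVec]

lemma dualStep_eq (x xhat : V × Fin d → ℝ) (q : DualIdx G d → ℝ) :
    obs.dualStep net k x xhat q =
      q - obs.α • (obs.matF net k *ᵥ q) + obs.α • obs.vecC net k x xhat := by
  have h1 : obs.matF net k *ᵥ q = q + permP G d *ᵥ q - (2 * obs.ρ) • (permP G d *ᵥ (matAq G d *ᵥ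
      ((obs.Hrho net k)⁻¹ *ᵥ ((matAq G d)ᵀ *ᵥ q)))) := by
    simp only [matF, Matrix.sub_mulVec, Matrix.add_mulVec, Matrix.one_mulVec, Matrix.smul_mulVec,
      ← Matrix.mulVec_mulVec]
  have h2 : q - obs.α • (obs.matF net k *ᵥ q) + obs.α • obs.vecC net k x xhat =
      (1 - obs.α) • q + obs.α • (-(permP G d *ᵥ q) + (2 * obs.ρ) •
        (permP G d *ᵥ (matAq G d *ᵥ obs.primal net k x xhat q))) := by
    rw [h1, vecC, primal]
    simp only [← Matrix.mulVec_mulVec, Matrix.mulVec_add]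
    module
  rw [h2]
  funext ⟨s, a⟩
  cases s <;> simp [dualStep, permP_mulVec, matAq_mulVec, dualSwap, dualVar] <;> ring

section Positivity

variable {net obs}

lemma Jl_posSemidef (hobs : obs.Admissible net) (i : V) : (obs.Jl net k i).PosSemidef := by
  obtain ⟨r, hr, h⟩ := hobs.gain_l
  rw [Jl]
  split_ifs with hi
  · refine posSemidef_congruence ?_ _
    have := (h k i hi).add (Matrix.PosSemidef.one.smul hr.le)
    rwa [sub_add_cancel] at this
  · exact Matrix.PosSemidef.zero

lemma Je_posSemidef (hobs : obs.Admissible net) (e : G.Dart) : (obs.Je net k e).PosSemidef := by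
  obtain ⟨r, hr, h⟩ := hobs.gain_r
  have hR : ∀ i j, (i, j) ∈ net.Es → (obs.Rr k i j).PosSemidef := fun i j hij => by
    have := (h k i j hij).add (Matrix.PosSemidef.one.smul hr.le)
    rwa [sub_add_cancel] at this
  rw [Je]
  refine Matrix.PosSemidef.add ?_ ?_ <;> split_ifs with hi
  · exact posSemidef_congruence (hR _ _ hi) _
  · exact Matrix.PosSemidef.zero
  · exact posSemidef_congruence (hR _ _ hi) _
  · exact Matrix.PosSemidef.zero

lemma SlPrior_posSemidef (hobs : obs.Admissible net) (i : V) : (obs.SlPrior net k i).PosSemidef := by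
  induction k with
  | zero => exact hobs.init_l i
  | succ k ih =>
    exact (posSemidef_congruence (ih.add ((Jl_posSemidef k hobs i).smul hobs.ε_pos.le)) _).smul
      hobs.γ_pos.le

lemma SePrior_posSemidef (hobs : obs.Admissible net) (e : G.Dart) :
    (obs.SePrior net k e).PosSemidef := by
  induction k with
  | zero => exact hobs.init_e e
  | succ k ih =>
    exact (posSemidef_congruence (ih.add ((Je_posSemidef k hobs e).smul hobs.ε_pos.le)) _).smul
      hobs.γ_pos.le

lemma SlPost_posSemidef (hobs : obs.Admissible net) (i : V) : (obs.SlPost net k i).PosSemidef :=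
  (SlPrior_posSemidef k hobs i).add ((Jl_posSemidef k hobs i).smul hobs.ε_pos.le)

lemma SePost_posSemidef (hobs : obs.Admissible net) (e : G.Dart) :
    (obs.SePost net k e).PosSemidef :=
  (SePrior_posSemidef k hobs e).add ((Je_posSemidef k hobs e).smul hobs.ε_pos.le)

lemma hessPrior_posSemidef (hobs : obs.Admissible net) : (obs.hessPrior net k).PosSemidef :=
  posSemidef_assembleCopies (SlPrior_posSemidef k hobs) (SePrior_posSemidef k hobs)

lemma hessPost_posSemidef (hobs : obs.Admissible net) : (obs.hessPost net k).PosSemidef :=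
  posSemidef_assembleCopies (SlPost_posSemidef k hobs) (SePost_posSemidef k hobs)

lemma hessMeas_posSemidef (hobs : obs.Admissible net) : (obs.hessMeas net k).PosSemidef :=
  posSemidef_assembleCopies (Jl_posSemidef k hobs) (Je_posSemidef k hobs)

lemma bigHRH_posSemidef (hobs : obs.Admissible net) :
    ((net.bigH k)ᵀ * obs.bigR net k * net.bigH k).PosSemidef := by
  rw [← hessMeas_global]
  exact posSemidef_congruence (hessMeas_posSemidef k hobs) _

lemma SPrior_posSemidef (hobs : obs.Admissible net) (h : ∀ k, IsUnit (net.bigA k)) :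
    (obs.SPrior net k).PosSemidef := by
  rw [← hessPrior_global _ _ _ h]
  exact posSemidef_congruence (hessPrior_posSemidef k hobs) _

lemma SPost_posSemidef (hobs : obs.Admissible net) (h : ∀ k, IsUnit (net.bigA k)) :
    (obs.SPost net k).PosSemidef := by
  rw [← hessPost_global _ _ _ h]
  exact posSemidef_congruence (hessPost_posSemidef k hobs) _

/-- Measurements never decrease the information. -/
lemma SPrior_le_SPost (hobs : obs.Admissible net) (v : V × Fin d → ℝ) :
    v ⬝ᵥ (obs.SPrior net k *ᵥ v) ≤ v ⬝ᵥ (obs.SPost net k *ᵥ v) := by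
  have := (posSemidef_iff_real.mp ((bigHRH_posSemidef k hobs).smul hobs.ε_pos.le)).2 v
  rw [SPost, Matrix.add_mulVec, dotProduct_add]
  linarith

/-- Prediction transports the information along the dynamics and discounts it by `γ`. -/
lemma quadForm_SPrior_succ (h : ∀ k, IsUnit (net.bigA k)) (v : V × Fin d → ℝ) :
    (net.bigA k *ᵥ v) ⬝ᵥ (obs.SPrior net (k + 1) *ᵥ (net.bigA k *ᵥ v)) =
      obs.γ * (v ⬝ᵥ (obs.SPost net k *ᵥ v)) := by
  have hu := (Matrix.isUnit_iff_isUnit_det _).mp (h k)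
  rw [SPrior, Matrix.smul_mulVec, dotProduct_smul, smul_eq_mul, dotProduct_congruence,
    Matrix.mulVec_mulVec, Matrix.nonsing_inv_mul _ hu, Matrix.one_mulVec]
  rfl

end Positivity

end Observer

end DistObs

namespace DistObs

/-! ### Interconnections of two contracting recursions -/

/-- Small-gain lemma for two coupled scalar recursions. The weight `w` makes `V + w D` a Lyapunov
function; it exists because the loop gain `b * c` is below `(1 - s) * (1 - β)`. -/
lemma smallGain_decay {s b c β : ℝ} (hs : 0 < s) (hb : 0 < b) (hc : 0 < c)
    (hβ1 : β < 1) (hgain : b * c < (1 - s) * (1 - β)) :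
    ∃ C lam : ℝ, 0 < C ∧ 0 < lam ∧ lam < 1 ∧ ∀ (k₀ : ℕ) (U D : ℕ → ℝ), (∀ k, 0 ≤ U k) →
      (∀ k, 0 ≤ D k) → (∀ k, k₀ ≤ k → U (k + 1) ≤ s * U k + b * D k) →
      (∀ k, k₀ ≤ k → D (k + 1) ≤ c * U k + β * D k) →
      ∀ k, k₀ ≤ k → U k + D k ≤ C * lam ^ (k - k₀) * (U k₀ + D k₀) := by
  have h1β : 0 < 1 - β := by linarith
  obtain ⟨w, hw1, hw2⟩ : ∃ w, b / (1 - β) < w ∧ w < (1 - s) / c := by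
    refine exists_between ?_
    rw [div_lt_div_iff₀ h1β hc]
    linarith
  have hw : 0 < w := lt_trans (by positivity) hw1
  rw [div_lt_iff₀ h1β] at hw1
  rw [lt_div_iff₀ hc] at hw2
  have hl2 : (b + w * β) / w < 1 := by rw [div_lt_one hw]; linarith
  refine ⟨(1 + 1 / w) * (1 + w), max (s + w * c) ((b + w * β) / w), by positivity,
    lt_max_of_lt_left (by positivity), max_lt (by linarith) hl2, ?_⟩
  set lam := max (s + w * c) ((b + w * β) / w) with hlam
  have hlam0 : 0 < lam := lt_max_of_lt_left (by positivity)
  intro k₀ U D hU hD hUs hDs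
  have hdecay : ∀ n, U (k₀ + n) + w * D (k₀ + n) ≤ lam ^ n * (U k₀ + w * D k₀) := by
    intro n
    induction n with
    | zero => simp
    | succ n ih =>
      have e1 := hUs (k₀ + n) (by omega)
      have e2 := mul_le_mul_of_nonneg_left (hDs (k₀ + n) (by omega)) hw.le
      have e3 : (s + w * c) * U (k₀ + n) ≤ lam * U (k₀ + n) :=
        mul_le_mul_of_nonneg_right (le_max_left _ _) (hU _)
      have e4 : (b + w * β) * D (k₀ + n) ≤ lam * w * D (k₀ + n) := by
        refine mul_le_mul_of_nonneg_right ?_ (hD _)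
        rw [← div_le_iff₀ hw]
        exact le_max_right _ _
      have e5 := mul_le_mul_of_nonneg_left ih hlam0.le
      rw [← add_assoc, pow_succ']
      nlinarith
  intro k hk
  obtain ⟨n, rfl⟩ := Nat.exists_eq_add_of_le hk
  rw [Nat.add_sub_cancel_left]
  have f1 : U (k₀ + n) + D (k₀ + n) ≤ (1 + 1 / w) * (U (k₀ + n) + w * D (k₀ + n)) := by
    have g1 : 0 ≤ 1 / w * U (k₀ + n) := mul_nonneg (by positivity) (hU _)
    have g2 : 0 ≤ w * D (k₀ + n) := mul_nonneg hw.le (hD _)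
    have g3 : 1 / w * (w * D (k₀ + n)) = D (k₀ + n) := by field_simp
    nlinarith
  have f2 : U k₀ + w * D k₀ ≤ (1 + w) * (U k₀ + D k₀) := by
    nlinarith [hU k₀, hD k₀, mul_nonneg hw.le (hU k₀)]
  calc U (k₀ + n) + D (k₀ + n) ≤ (1 + 1 / w) * (U (k₀ + n) + w * D (k₀ + n)) := f1
    _ ≤ (1 + 1 / w) * (lam ^ n * ((1 + w) * (U k₀ + D k₀))) := by
        gcongr
        exact (hdecay n).trans (by gcongr)
    _ = _ := by ring

/-! ### One step of the interconnection -/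

section Interconnection

variable {V : Type*} [Fintype V] [DecidableEq V] {G : SimpleGraph V} [DecidableRel G.Adj]
  {d m ql qr : ℕ} {net : Network G d m ql qr} {obs : Observer G d ql qr}

namespace Observer

variable (k : ℕ)

lemma Qeq_eq_solSet (x xhat : V × Fin d → ℝ) :
    obs.Qeq net k x xhat = solSet (obs.matF net k) (obs.vecC net k x xhat) := rfl

variable {k}

lemma exists_mem_Qeq (hobs : obs.Admissible net) (h : ∀ k, IsUnit (net.bigA k))
    (hS : (obs.SPost net k).PosDef) (x xhat : V × Fin d → ℝ) :
    ∃ v, obs.matF net k *ᵥ v = obs.vecC net k x xhat := by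
  rw [matF_eq, vecC, Hrho_eq]
  exact exists_equilibrium (isConsensus G d) hobs.ρ_pos (hessPost_posSemidef k hobs)
    (by rwa [hessPost_global _ _ _ h]) _

/-- With an equilibrium dual variable, the own copies carry the exact centralized correction. -/
lemma errPhi_mulVec_of_equilibrium (hobs : obs.Admissible net) (h : ∀ k, IsUnit (net.bigA k))
    (hS : (obs.SPost net k).PosDef) (x xhat : V × Fin d → ℝ) {v : DualIdx G d → ℝ}
    (hv : obs.matF net k *ᵥ v = obs.vecC net k x xhat) :
    net.bigA k *ᵥ ((x - xhat) - obs.ε • (matSigma G d *ᵥ obs.primal net k x xhat v)) =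
      obs.errPhi net k *ᵥ (x - xhat) := by
  have hS' : ((copyE G d)ᵀ * obs.hessPost net k * copyE G d).PosDef := by
    rwa [hessPost_global _ _ _ h]
  rw [matF_eq, vecC, Hrho_eq] at hv
  obtain ⟨-, -, h3⟩ := equilibrium_primal (isConsensus G d) hobs.ρ_pos
    (hessPost_posSemidef k hobs) hS' _ v hv
  have hb : (copyE G d)ᵀ *ᵥ obs.bBar net k x xhat =
      ((net.bigH k)ᵀ * obs.bigR net k * net.bigH k) *ᵥ (x - xhat) := by
    rw [bBar_eq, Matrix.mulVec_mulVec, ← Matrix.mul_assoc, hessMeas_global]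
  rw [← Hrho_eq, hessPost_global _ _ _ h, hb] at h3
  have hu := (Matrix.isUnit_iff_isUnit_det _).mp hS.isUnit
  set y := matSigma G d *ᵥ obs.primal net k x xhat v with hy
  have h3' : obs.SPost net k *ᵥ y =
    ((net.bigH k)ᵀ * obs.bigR net k * net.bigH k) *ᵥ (x - xhat) := h3
  have h4 : obs.SPost net k *ᵥ ((x - xhat) - obs.ε • y) = obs.SPrior net k *ᵥ (x - xhat) := by
    rw [Matrix.mulVec_sub, Matrix.mulVec_smul, h3', SPost, Matrix.add_mulVec, Matrix.smul_mulVec,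
      add_sub_cancel_right]
  rw [errPhi, ← Matrix.mulVec_mulVec, ← h4, Matrix.mulVec_mulVec, Matrix.mul_assoc,
    Matrix.nonsing_inv_mul _ hu, Matrix.mul_one]

end Observer

namespace GainConstants

variable {c : GainConstants}

namespace Valid

variable (hc : c.Valid net obs) (hobs : obs.Admissible net) (h : ∀ k, IsUnit (net.bigA k))
include hc

lemma SPrior_lower (k : ℕ) (v : V × Fin d → ℝ) :
    c.sLo * ‖euc v‖ ^ 2 ≤ v ⬝ᵥ (obs.SPrior net k *ᵥ v) :=
  (posSemidef_sub_smul_one_iff.mp (hc.info_lower k)).2 v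

lemma SPost_upper (k : ℕ) (v : V × Fin d → ℝ) :
    v ⬝ᵥ (obs.SPost net k *ᵥ v) ≤ c.sHi * ‖euc v‖ ^ 2 :=
  (posSemidef_smul_one_sub_iff.mp (hc.info_upper k)).2 v

lemma norm_vecC_le (k : ℕ) (x xhat : V × Fin d → ℝ) :
    ‖euc (obs.vecC net k x xhat)‖ ≤ c.MBar * ‖euc (x - xhat)‖ := by
  rw [Observer.vecC_eq]
  exact (norm_euc_mulVec_le _ _).trans (by gcongr; exact hc.norm_M k)

lemma norm_euc_le_sqrt (k : ℕ) (v : V × Fin d → ℝ) :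
    ‖euc v‖ ≤ √(v ⬝ᵥ (obs.SPrior net k *ᵥ v)) / √c.sLo := by
  rw [le_div_iff₀ (Real.sqrt_pos.mpr hc.sLo_pos)]
  refine Real.le_sqrt_of_sq_le ?_
  rw [mul_pow, Real.sq_sqrt hc.sLo_pos.le, mul_comm]
  exact hc.SPrior_lower k v

lemma FVar_nonneg : 0 ≤ c.FVar := (norm_nonneg _).trans (hc.var_F 0)

lemma MVar_nonneg : 0 ≤ c.MVar := (norm_nonneg _).trans (hc.var_M 0)

lemma cPhi_nonneg : 0 ≤ c.cPhi := (norm_nonneg _).trans (hc.norm_Phi 0)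

lemma c12_pos : 0 < c.c12 := by
  have h1 := hc.sHi_pos
  have h2 := hc.aBar_pos
  have h3 := hc.cH_pos
  unfold c12
  positivity

lemma c21_pos : 0 < c.c21 := by
  have h1 := hc.sLo_pos
  have h2 := hc.FDag_pos
  have h3 := hc.MBar_pos
  have h4 := hc.FVar_nonneg
  have h5 := hc.MVar_nonneg
  have h6 := hc.cPhi_nonneg
  unfold c21
  positivity

lemma c22_pos : 0 < c.c22 := by
  have h1 := hc.aBar_pos
  have h2 := hc.FDag_pos
  have h3 := hc.MBar_pos
  have h4 := hc.cH_pos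
  unfold c22
  positivity

lemma μ_pos : 0 < c.μ obs.α := Real.sqrt_pos.mpr hc.contraction

include hobs

lemma μ_lt_one : c.μ obs.α < 1 := by
  have h1 := hc.σ_pos
  have h2 := hobs.α_pos
  have h3 : 0 < 1 - obs.α := by linarith [hobs.α_lt]
  have h4 : 0 < (1 - obs.α) / (obs.α * c.σ ^ 2) := by positivity
  unfold μ
  rw [Real.sqrt_lt' one_pos]
  linarith

include h

lemma SPost_posDef (k : ℕ) : (obs.SPost net k).PosDef :=
  posDef_of_lower_bound hc.sLo_pos
    (posSemidef_iff_real.mp (Observer.SPost_posSemidef k hobs h)).1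
    fun v => (hc.SPrior_lower k v).trans (Observer.SPrior_le_SPost k hobs v)

lemma exists_eq (k : ℕ) (x xhat : V × Fin d → ℝ) :
    ∃ v, obs.matF net k *ᵥ v = obs.vecC net k x xhat :=
  Observer.exists_mem_Qeq hobs h (hc.SPost_posDef hobs h k) x xhat

lemma posDef_global (k : ℕ) :
    ((copyE G d)ᵀ * obs.hessPost net k * copyE G d).PosDef := by
  rw [Observer.hessPost_global _ _ _ h]
  exact hc.SPost_posDef hobs h k

lemma infDist_dualStep_le (k : ℕ) (x xhat : V × Fin d → ℝ) (v : DualIdx G d → ℝ) :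
    Metric.infDist (euc (obs.dualStep net k x xhat v)) (obs.Qeq net k x xhat) ≤
      c.μ obs.α * Metric.infDist (euc v) (obs.Qeq net k x xhat) := by
  obtain ⟨B, hB, hBn⟩ := hc.pinv_F k
  have hex := hc.exists_eq hobs h k x xhat
  rw [Observer.dualStep_eq, Observer.Qeq_eq_solSet]
  rw [Observer.matF_eq] at hB hex ⊢
  exact infDist_relaxed_le (isConsensus G d) hobs.ρ_pos (Observer.hessPost_posSemidef k hobs)
    (hc.posDef_global hobs h k) hB hc.FDag_pos hBn hobs.α_pos hobs.α_lt hc.subregular hex v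

section Solution

variable {k₀ : ℕ} {x xhat : ℕ → V × Fin d → ℝ} {q : ℕ → ℕ → DualIdx G d → ℝ}
  (hsol : obs.IsSolution net k₀ x xhat q) {k : ℕ} (hk : k₀ ≤ k)
include hsol hk

lemma infDist_iterate_le :
    Metric.infDist (euc (q k obs.nIter)) (obs.Qeq net k (x k) (xhat k)) ≤
      c.μ obs.α ^ obs.nIter * Metric.infDist (euc (q k 0)) (obs.Qeq net k (x k) (xhat k)) := by
  have : ∀ j, j ≤ obs.nIter →
      Metric.infDist (euc (q k j)) (obs.Qeq net k (x k) (xhat k)) ≤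
      c.μ obs.α ^ j * Metric.infDist (euc (q k 0)) (obs.Qeq net k (x k) (xhat k)) := by
    intro j hj
    induction j with
    | zero => simp
    | succ j ih =>
      rw [hsol.dual k hk j (by omega), pow_succ', mul_assoc]
      exact (hc.infDist_dualStep_le hobs h k _ _ _).trans
        (mul_le_mul_of_nonneg_left (ih (by omega)) (hc.μ_pos).le)
  exact this _ le_rfl

/-- The estimation error follows the exact error dynamics up to a perturbation proportional to the
distance of the dual variable from the ADMM equilibria. -/
lemma exists_error_step :
    ∃ w : V × Fin d → ℝ, x (k + 1) - xhat (k + 1) =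
        obs.errPhi net k *ᵥ (x k - xhat k) - obs.ε • (net.bigA k *ᵥ w) ∧
      ‖euc w‖ ≤ c.cH * Metric.infDist (euc (q k obs.nIter)) (obs.Qeq net k (x k) (xhat k)) := by
  obtain ⟨B, hB, hBn⟩ := hc.pinv_F k
  have hex := hc.exists_eq hobs h k (x k) (xhat k)
  set p := B *ᵥ (obs.matF net k *ᵥ q k obs.nIter - obs.vecC net k (x k) (xhat k)) with hp
  have hmem : obs.matF net k *ᵥ (q k obs.nIter - p) = obs.vecC net k (x k) (xhat k) :=
    sub_pinv_mem_solSet hB hex (q k obs.nIter)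
  refine ⟨(matSigma G d * (obs.Hrho net k)⁻¹ * (matAq G d)ᵀ) *ᵥ p, ?_, ?_⟩
  · rw [← Observer.errPhi_mulVec_of_equilibrium hobs h (hc.SPost_posDef hobs h k) _ _ hmem,
      hsol.plant k hk, hsol.estimate k hk]
    have e1 : obs.primal net k (x k) (xhat k) (q k obs.nIter) =
        obs.primal net k (x k) (xhat k) (q k obs.nIter - p) +
          (obs.Hrho net k)⁻¹ *ᵥ ((matAq G d)ᵀ *ᵥ p) := by
      rw [Observer.primal, Observer.primal, ← Matrix.mulVec_add, add_assoc, ← Matrix.mulVec_add,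
        sub_add_cancel]
    rw [e1]
    simp only [← Matrix.mulVec_mulVec, Matrix.mulVec_add, Matrix.mulVec_sub, Matrix.mulVec_smul]
    module
  · rw [Observer.Qeq_eq_solSet, infDist_solSet hB hex]
    exact (norm_euc_mulVec_le _ _).trans (by gcongr; exact hc.output_gain k)

/-- One step of the estimation error in the information norm. -/
lemma error_energy_step :
    √((x (k + 1) - xhat (k + 1)) ⬝ᵥ (obs.SPrior net (k + 1) *ᵥ (x (k + 1) - xhat (k + 1)))) ≤
      √obs.γ * √((x k - xhat k) ⬝ᵥ (obs.SPrior net k *ᵥ (x k - xhat k))) +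
      obs.ε * c.c12 *
        Metric.infDist (euc (q k obs.nIter)) (obs.Qeq net k (x k) (xhat k)) := by
  obtain ⟨w, hw, hwn⟩ := hc.exists_error_step hobs h hsol hk
  set D := Metric.infDist (euc (q k obs.nIter)) (obs.Qeq net k (x k) (xhat k))
  set e := x k - xhat k
  have hp1 := (posSemidef_iff_real.mp (Observer.SPrior_posSemidef k hobs h))
  rw [hw, sub_eq_add_neg]
  refine (sqrt_quadForm_add_le (Observer.SPrior_posSemidef (k + 1) hobs h) _ _).trans
    (add_le_add ?_ ?_)
  · rw [← Real.sqrt_mul hobs.γ_pos.le]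
    apply Real.sqrt_le_sqrt
    rw [Observer.errPhi, Matrix.mul_assoc, ← Matrix.mulVec_mulVec,
      Observer.quadForm_SPrior_succ k h]
    exact mul_le_mul_of_nonneg_left (quadForm_inv_mul_le (hc.SPost_posDef hobs h k) hp1.1
      (Observer.SPrior_le_SPost k hobs) hp1.2 e) hobs.γ_pos.le
  · have h1 : ‖euc (-(obs.ε • (net.bigA k *ᵥ w)))‖ ≤ obs.ε * (c.aBar * (c.cH * D)) := by
      rw [← neg_smul, norm_euc_smul, abs_neg, abs_of_pos hobs.ε_pos]
      have := hobs.ε_pos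
      have := hc.aBar_pos
      gcongr
      exact (norm_euc_mulVec_le _ _).trans
        (mul_le_mul (hc.norm_A k) hwn (norm_nonneg _) hc.aBar_pos.le)
    set u := -(obs.ε • (net.bigA k *ᵥ w))
    calc √(u ⬝ᵥ (obs.SPrior net (k + 1) *ᵥ u)) ≤ √(c.sHi * ‖euc u‖ ^ 2) :=
          Real.sqrt_le_sqrt
            ((Observer.SPrior_le_SPost (k + 1) hobs u).trans (hc.SPost_upper (k + 1) u))
      _ = √c.sHi * ‖euc u‖ := by
          rw [Real.sqrt_mul hc.sHi_pos.le, Real.sqrt_sq (norm_nonneg _)]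
      _ ≤ √c.sHi * (obs.ε * (c.aBar * (c.cH * D))) := by gcongr
      _ = obs.ε * c.c12 * D := by unfold c12; ring

/-- The drift of the equilibrium set is controlled by the estimation error. An equilibrium can have
an arbitrarily large component along the kernel of `F_k`, but this component does not contribute to
the drift because the kernel is the same at time `k + 1`. -/
lemma dual_dist_step :
    Metric.infDist (euc (q (k + 1) 0)) (obs.Qeq net (k + 1) (x (k + 1)) (xhat (k + 1))) ≤
      c.c21 * √((x k - xhat k) ⬝ᵥ (obs.SPrior net k *ᵥ (x k - xhat k))) +
      (1 + obs.ε * c.c22) *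
        Metric.infDist (euc (q k obs.nIter)) (obs.Qeq net k (x k) (xhat k)) := by
  obtain ⟨w, hw, hwn⟩ := hc.exists_error_step hobs h hsol hk
  obtain ⟨B, hB, hBn⟩ := hc.pinv_F k
  obtain ⟨B', hB', hBn'⟩ := hc.pinv_F (k + 1)
  have hex := hc.exists_eq hobs h k (x k) (xhat k)
  have hex' := hc.exists_eq hobs h (k + 1) (x (k + 1)) (xhat (k + 1))
  rw [hsol.warm k hk]
  set D := Metric.infDist (euc (q k obs.nIter)) (obs.Qeq net k (x k) (xhat k)) with hD
  set e := x k - xhat k with he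
  set e' := x (k + 1) - xhat (k + 1) with he'
  set F := obs.matF net k with hF
  set F' := obs.matF net (k + 1) with hF'
  set cv := obs.vecC net k (x k) (xhat k) with hcv
  set cv' := obs.vecC net (k + 1) (x (k + 1)) (xhat (k + 1)) with hcv'
  set p := B *ᵥ (F *ᵥ q k obs.nIter - cv) with hp
  -- the projection of the current dual variable onto the current equilibria
  set r := q k obs.nIter - p with hr
  have hmem : F *ᵥ r = cv := sub_pinv_mem_solSet hB hex (q k obs.nIter)
  -- the equilibrium of minimal norm
  set r₀ := B *ᵥ cv with hr₀
  have hmem₀ : F *ᵥ r₀ = cv := by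
    rw [hr₀, ← hmem, Matrix.mulVec_mulVec, Matrix.mulVec_mulVec, hB.1]
  have hker : F' *ᵥ r = F' *ᵥ r₀ := by
    have h0 : F *ᵥ (r - r₀) = 0 := by rw [Matrix.mulVec_sub, hmem, hmem₀, sub_self]
    rw [hF, Observer.matF_eq, admmOp_mulVec_eq_zero_iff (isConsensus G d) hobs.ρ_pos
      (Observer.hessPost_posSemidef k hobs) (hc.posDef_global hobs h k)] at h0
    rw [← admmOp_mulVec_eq_zero_iff (isConsensus G d) hobs.ρ_pos
      (Observer.hessPost_posSemidef (k + 1) hobs) (hc.posDef_global hobs h (k + 1)),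
      ← Observer.matF_eq, Matrix.mulVec_sub] at h0
    exact sub_eq_zero.mp h0
  have hr₀n : ‖euc r₀‖ ≤ c.FDag * (c.MBar * ‖euc e‖) :=
    (norm_euc_mulVec_le _ _).trans
      (mul_le_mul hBn (hc.norm_vecC_le k _ _) (norm_nonneg _) hc.FDag_pos.le)
  have hdiff : ‖euc (e' - e)‖ ≤ (1 + c.cPhi) * ‖euc e‖ + obs.ε * (c.aBar * (c.cH * D)) := by
    have e1 : e' - e = obs.errPhi net k *ᵥ e - e - obs.ε • (net.bigA k *ᵥ w) := by
      rw [hw]; abel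
    have n1 : ‖euc (obs.errPhi net k *ᵥ e)‖ ≤ c.cPhi * ‖euc e‖ :=
      (norm_euc_mulVec_le _ _).trans (by gcongr; exact hc.norm_Phi k)
    have n2 : ‖euc (obs.ε • (net.bigA k *ᵥ w))‖ ≤ obs.ε * (c.aBar * (c.cH * D)) := by
      rw [norm_euc_smul, abs_of_pos hobs.ε_pos]
      have := hobs.ε_pos
      gcongr
      exact (norm_euc_mulVec_le _ _).trans
        (mul_le_mul (hc.norm_A k) hwn (norm_nonneg _) hc.aBar_pos.le)
    rw [e1]
    have n3 := norm_euc_sub_le (obs.errPhi net k *ᵥ e - e) (obs.ε • (net.bigA k *ᵥ w))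
    have n4 := norm_euc_sub_le (obs.errPhi net k *ᵥ e) e
    linarith
  have hres : ‖euc (F' *ᵥ r - cv')‖ ≤ c.FVar * (c.FDag * (c.MBar * ‖euc e‖)) +
      (c.MBar * ((1 + c.cPhi) * ‖euc e‖ + obs.ε * (c.aBar * (c.cH * D))) +
        c.MVar * ‖euc e‖) := by
    have e1 : F' *ᵥ r - cv' = (F' - F) *ᵥ r₀ - obs.matM net (k + 1) *ᵥ (e' - e) -
        (obs.matM net (k + 1) - obs.matM net k) *ᵥ e := by
      have e2 : cv' = obs.matM net (k + 1) *ᵥ e' := Observer.vecC_eq _ _ _ _ _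
      have e3 : F *ᵥ r₀ = obs.matM net k *ᵥ e := hmem₀.trans (Observer.vecC_eq _ _ _ _ _)
      rw [hker, e2, Matrix.sub_mulVec, Matrix.mulVec_sub _ e' e, Matrix.sub_mulVec, e3]
      abel
    rw [e1, ← add_assoc]
    refine (norm_euc_sub_le _ _).trans (add_le_add
      ((norm_euc_sub_le _ _).trans (add_le_add ?_ ?_)) ?_)
    · exact (norm_euc_mulVec_le _ _).trans
        (mul_le_mul (hc.var_F k) hr₀n (norm_nonneg _) hc.FVar_nonneg)
    · exact (norm_euc_mulVec_le _ _).trans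
        (mul_le_mul (hc.norm_M (k + 1)) hdiff (norm_nonneg _) hc.MBar_pos.le)
    · exact (norm_euc_mulVec_le _ _).trans (by gcongr; exact hc.var_M k)
  have hdist : dist (euc (q k obs.nIter)) (euc r) = D := by
    rw [dist_eq_norm, ← WithLp.toLp_sub, hr, sub_sub_cancel, hD, Observer.Qeq_eq_solSet,
      infDist_solSet hB hex]
  have hfin : Metric.infDist (euc (q k obs.nIter))
      (obs.Qeq net (k + 1) (x (k + 1)) (xhat (k + 1))) ≤
      c.FDag * ‖euc (F' *ᵥ r - cv')‖ + D := by
    rw [← hdist]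
    refine (Metric.infDist_le_infDist_add_dist (y := euc r)).trans ?_
    gcongr
    rw [Observer.Qeq_eq_solSet, infDist_solSet hB' hex']
    exact (norm_euc_mulVec_le _ _).trans (by gcongr)
  refine hfin.trans ?_
  have hFD := hc.FDag_pos
  have hMB := hc.MBar_pos
  have hFV := hc.FVar_nonneg
  have hMV := hc.MVar_nonneg
  have hcP := hc.cPhi_nonneg
  have hne := hc.norm_euc_le_sqrt k e
  calc c.FDag * ‖euc (F' *ᵥ r - cv')‖ + D
      ≤ c.FDag * (c.FVar * (c.FDag * (c.MBar * ‖euc e‖)) +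
        (c.MBar * ((1 + c.cPhi) * ‖euc e‖ + obs.ε * (c.aBar * (c.cH * D))) +
          c.MVar * ‖euc e‖)) + D := by gcongr
    _ = c.FDag * (c.FVar * c.FDag * c.MBar + (c.MBar * (1 + c.cPhi) + c.MVar)) * ‖euc e‖ +
        (1 + obs.ε * c.c22) * D := by unfold c22; ring
    _ ≤ c.FDag * (c.FVar * c.FDag * c.MBar + (c.MBar * (1 + c.cPhi) + c.MVar)) *
        (√(e ⬝ᵥ (obs.SPrior net k *ᵥ e)) / √c.sLo) + (1 + obs.ε * c.c22) * D := by gcongr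
    _ = _ := by unfold c21; ring

end Solution

/-! ### Distance to the target set -/

lemma targetSet_nonempty (k : ℕ) (x : V × Fin d → ℝ) : (obs.targetSet net k x).Nonempty := by
  obtain ⟨v, hv⟩ := hc.exists_eq hobs h k x x
  refine ⟨WithLp.toLp 2 (0, euc v), rfl, ?_⟩
  simpa [Observer.Qeq] using hv

/-- The two distances by which convergence is measured are equivalent. -/
lemma targetDist_equiv (k : ℕ) (x xhat : V × Fin d → ℝ) (v : DualIdx G d → ℝ) :
    Metric.infDist (WithLp.toLp 2 (euc (x - xhat), euc v)) (obs.targetSet net k x) ≤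
      (1 + c.FDag * c.MBar) *
        (‖euc (x - xhat)‖ + Metric.infDist (euc v) (obs.Qeq net k x xhat)) ∧
    ‖euc (x - xhat)‖ + Metric.infDist (euc v) (obs.Qeq net k x xhat) ≤
      (2 + c.FDag * c.MBar) *
        Metric.infDist (WithLp.toLp 2 (euc (x - xhat), euc v)) (obs.targetSet net k x) := by
  obtain ⟨B, hB, hBn⟩ := hc.pinv_F k
  have hex := hc.exists_eq hobs h k x xhat
  have hc0 : obs.vecC net k x x = 0 := by rw [Observer.vecC_eq, sub_self, Matrix.mulVec_zero]
  have hex0 : ∃ v, obs.matF net k *ᵥ v = 0 := ⟨0, Matrix.mulVec_zero _⟩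
  have hD : Metric.infDist (euc v) (obs.Qeq net k x xhat) =
      ‖euc (B *ᵥ (obs.matF net k *ᵥ v - obs.vecC net k x xhat))‖ := by
    rw [Observer.Qeq_eq_solSet, infDist_solSet hB hex]
  have hN := infDist_solSet hB hex0 v
  have hBc : ‖euc (B *ᵥ obs.vecC net k x xhat)‖ ≤ c.FDag * c.MBar * ‖euc (x - xhat)‖ := by
    rw [mul_assoc]
    exact (norm_euc_mulVec_le _ _).trans
      (mul_le_mul hBn (hc.norm_vecC_le k _ _) (norm_nonneg _) hc.FDag_pos.le)
  set D := Metric.infDist (euc v) (obs.Qeq net k x xhat)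
  set N := Metric.infDist (euc v) (solSet (obs.matF net k) 0)
  set T := Metric.infDist (WithLp.toLp 2 (euc (x - xhat), euc v)) (obs.targetSet net k x)
  set κ := c.FDag * c.MBar with hκ
  have hκ0 : 0 < κ := mul_pos hc.FDag_pos hc.MBar_pos
  have hsplit : B *ᵥ (obs.matF net k *ᵥ v) = B *ᵥ (obs.matF net k *ᵥ v - obs.vecC net k x xhat) +
      B *ᵥ obs.vecC net k x xhat := by
    rw [← Matrix.mulVec_add, sub_add_cancel]
  have hND : N ≤ D + κ * ‖euc (x - xhat)‖ := by
    rw [hN, hD, sub_zero, hsplit]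
    exact (norm_euc_add_le _ _).trans (by gcongr)
  have hDN : D ≤ N + κ * ‖euc (x - xhat)‖ := by
    rw [hN, hD, sub_zero, eq_sub_of_add_eq hsplit.symm]
    exact (norm_euc_sub_le _ _).trans (by gcongr)
  have hmem0 : ∀ p : WithLp 2 (EuclideanSpace ℝ (V × Fin d) × EuclideanSpace ℝ (DualIdx G d)),
      p ∈ obs.targetSet net k x ↔ p.fst = 0 ∧ p.snd ∈ solSet (obs.matF net k) 0 := by
    intro p
    refine and_congr_right fun hp => ?_
    rw [hp, WithLp.ofLp_zero, sub_zero, Observer.Qeq_eq_solSet, hc0]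
  have hT1 : T ≤ ‖euc (x - xhat)‖ + N := by
    refine (Metric.infDist_le_dist_of_mem (y := WithLp.toLp 2
      (0, euc (v - B *ᵥ (obs.matF net k *ᵥ v - 0)))) ?_).trans ?_
    · rw [hmem0]
      exact ⟨rfl, sub_pinv_mem_solSet hB hex0 v⟩
    · rw [WithLp.prod_dist_eq_of_L2]
      change √(dist (euc (x - xhat)) 0 ^ 2 +
        dist (euc v) (euc (v - B *ᵥ (obs.matF net k *ᵥ v - 0))) ^ 2) ≤ _
      rw [dist_zero_right, dist_eq_norm (euc v), ← WithLp.toLp_sub, sub_sub_cancel, ← hN]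
      have : 0 ≤ N := Metric.infDist_nonneg
      rw [Real.sqrt_le_left (by positivity)]
      nlinarith [mul_nonneg (norm_nonneg (euc (x - xhat))) this]
  have hT2 : ‖euc (x - xhat)‖ ≤ T ∧ N ≤ T := by
    have hne := hc.targetSet_nonempty hobs h k x
    constructor <;> refine (Metric.le_infDist hne).2 fun p hp => ?_ <;>
      rw [hmem0] at hp <;> rw [WithLp.prod_dist_eq_of_L2]
    · change _ ≤ √(dist (euc (x - xhat)) p.fst ^ 2 + dist (euc v) p.snd ^ 2)
      rw [hp.1, dist_zero_right]
      exact Real.le_sqrt_of_sq_le (le_add_of_nonneg_right (sq_nonneg _))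
    · change _ ≤ √(dist (euc (x - xhat)) p.fst ^ 2 + dist (euc v) p.snd ^ 2)
      exact (Metric.infDist_le_dist_of_mem hp.2).trans
        (Real.le_sqrt_of_sq_le (le_add_of_nonneg_left (sq_nonneg _)))
  constructor
  · have : 0 ≤ D := Metric.infDist_nonneg
    nlinarith [mul_nonneg hκ0.le this]
  · nlinarith [mul_le_mul_of_nonneg_left hT2.1 hκ0.le]

end Valid

end GainConstants

/-! ### Exponential stability -/

/-- The hypothesis on `ε` is stronger than needed: the loop gain carries an extra factor `μ ^ H ≤ 1`,
from the dual iterations preceding each correction. -/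
theorem exponential_stability {c : GainConstants} (hc : c.Valid net obs)
    (hobs : obs.Admissible net) (h : ∀ k, IsUnit (net.bigA k))
    (hε : obs.ε < (1 - √obs.γ) * (1 - c.μ obs.α ^ obs.nIter) /
        (c.c12 * c.c21 + (1 - √obs.γ) * c.c22)) :
    ∃ C lam : ℝ, 0 < C ∧ 0 < lam ∧ lam < 1 ∧
      ∀ (k₀ : ℕ) (x xhat : ℕ → V × Fin d → ℝ) (q : ℕ → ℕ → DualIdx G d → ℝ),
        obs.IsSolution net k₀ x xhat q → ∀ k, k₀ ≤ k →
          (obs.Qeq net k (x k) (xhat k)).Nonempty ∧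
          (obs.targetSet net k (x k)).Nonempty ∧
          ‖euc (x k - xhat k)‖ +
              Metric.infDist (euc (q k 0)) (obs.Qeq net k (x k) (xhat k)) ≤
            C * lam ^ (k - k₀) *
              (‖euc (x k₀ - xhat k₀)‖ +
                Metric.infDist (euc (q k₀ 0)) (obs.Qeq net k₀ (x k₀) (xhat k₀))) ∧
          Metric.infDist (WithLp.toLp 2 (euc (x k - xhat k), euc (q k 0)))
              (obs.targetSet net k (x k)) ≤
            C * lam ^ (k - k₀) *
              Metric.infDist (WithLp.toLp 2 (euc (x k₀ - xhat k₀), euc (q k₀ 0)))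
                (obs.targetSet net k₀ (x k₀)) := by
  have h12 := hc.c12_pos
  have h21 := hc.c21_pos
  have h22 := hc.c22_pos
  have hε0 := hobs.ε_pos
  have hμ0 := hc.μ_pos
  have hs0 : 0 < √obs.γ := Real.sqrt_pos.mpr hobs.γ_pos
  have hs1 : 0 < 1 - √obs.γ := by
    rw [sub_pos, Real.sqrt_lt' one_pos, one_pow]
    exact hobs.γ_lt
  set s := √obs.γ with hs
  set θ := c.μ obs.α ^ obs.nIter with hθ
  have hθ0 : 0 < θ := by positivity
  have hθ1 : θ ≤ 1 := pow_le_one₀ hμ0.le (hc.μ_lt_one hobs).le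
  rw [lt_div_iff₀ (by positivity)] at hε
  have hprod : obs.ε * θ * (c.c12 * c.c21 + (1 - s) * c.c22) < (1 - s) * (1 - θ) := by
    refine lt_of_le_of_lt ?_ hε
    have : 0 ≤ obs.ε * (c.c12 * c.c21 + (1 - s) * c.c22) := by positivity
    nlinarith
  have hβ1 : θ * (1 + obs.ε * c.c22) < 1 := by
    have h1 : 0 < obs.ε * θ * (c.c12 * c.c21) := by positivity
    have h2 : (1 - s) * (θ * (1 + obs.ε * c.c22)) < (1 - s) * 1 := by nlinarith
    exact lt_of_mul_lt_mul_left h2 hs1.le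
  obtain ⟨C, lam, hC, hl0, hl1, hdecay⟩ := smallGain_decay (s := s) (b := obs.ε * c.c12 * θ)
    (c := c.c21) (β := θ * (1 + obs.ε * c.c22)) hs0 (by positivity) h21 hβ1 (by nlinarith)
  have hlo := Real.sqrt_pos.mpr hc.sLo_pos
  have hhi := Real.sqrt_pos.mpr hc.sHi_pos
  have hκ0 : 0 < c.FDag * c.MBar := mul_pos hc.FDag_pos hc.MBar_pos
  set κ := c.FDag * c.MBar with hκ
  set C₁ := (1 + 1 / √c.sLo) * C * (1 + √c.sHi) with hC₁
  have hC₁0 : 0 < C₁ := by positivity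
  refine ⟨(1 + κ) * C₁ * (2 + κ), lam, by positivity, hl0, hl1, ?_⟩
  intro k₀ x xhat q hsol k hk
  set U : ℕ → ℝ := fun k => √((x k - xhat k) ⬝ᵥ (obs.SPrior net k *ᵥ (x k - xhat k))) with hU
  set D : ℕ → ℝ := fun k => Metric.infDist (euc (q k 0)) (obs.Qeq net k (x k) (xhat k)) with hD
  have hU0 : ∀ k, 0 ≤ U k := fun k => Real.sqrt_nonneg _
  have hD0 : ∀ k, 0 ≤ D k := fun k => Metric.infDist_nonneg
  have hUD := hdecay k₀ U D hU0 hD0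
    (fun k hk => by
      refine (hc.error_energy_step hobs h hsol hk).trans ?_
      have := hc.infDist_iterate_le hobs h hsol hk
      rw [mul_assoc (obs.ε * c.c12)]
      gcongr)
    (fun k hk => by
      refine (hc.dual_dist_step hobs h hsol hk).trans ?_
      have := hc.infDist_iterate_le hobs h hsol hk
      rw [mul_comm θ, mul_assoc (1 + obs.ε * c.c22)]
      gcongr) k hk
  have hUle : ∀ k, U k ≤ √c.sHi * ‖euc (x k - xhat k)‖ := fun k => by
    refine Real.sqrt_le_left (by positivity) |>.mpr ?_
    rw [mul_pow, Real.sq_sqrt hc.sHi_pos.le]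
    exact (Observer.SPrior_le_SPost k hobs _).trans (hc.SPost_upper k _)
  have hUge : ∀ k, ‖euc (x k - xhat k)‖ ≤ 1 / √c.sLo * U k := fun k => by
    rw [one_div_mul_eq_div]
    exact hc.norm_euc_le_sqrt k _
  have hmain : ‖euc (x k - xhat k)‖ + D k ≤
      C₁ * lam ^ (k - k₀) * (‖euc (x k₀ - xhat k₀)‖ + D k₀) := by
    have f1 : ‖euc (x k - xhat k)‖ + D k ≤ (1 + 1 / √c.sLo) * (U k + D k) := by
      have g1 : 0 ≤ 1 / √c.sLo * D k := mul_nonneg (by positivity) (hD0 k)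
      have := hUge k
      have := hU0 k
      linarith
    have f2 : U k₀ + D k₀ ≤ (1 + √c.sHi) * (‖euc (x k₀ - xhat k₀)‖ + D k₀) := by
      have g1 : 0 ≤ √c.sHi * D k₀ := mul_nonneg (by positivity) (hD0 k₀)
      have := hUle k₀
      have := norm_nonneg (euc (x k₀ - xhat k₀))
      linarith
    calc ‖euc (x k - xhat k)‖ + D k ≤ (1 + 1 / √c.sLo) * (U k + D k) := f1
      _ ≤ (1 + 1 / √c.sLo) * (C * lam ^ (k - k₀) *
          ((1 + √c.sHi) * (‖euc (x k₀ - xhat k₀)‖ + D k₀))) := by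
        gcongr
        exact hUD.trans (by gcongr)
      _ = _ := by rw [hC₁]; ring
  have hE0 : 0 ≤ ‖euc (x k₀ - xhat k₀)‖ + D k₀ := add_nonneg (norm_nonneg _) (hD0 _)
  have hpow : 0 < lam ^ (k - k₀) := by positivity
  obtain ⟨v, hv⟩ := hc.exists_eq hobs h k (x k) (xhat k)
  refine ⟨⟨euc v, hv⟩, hc.targetSet_nonempty hobs h k (x k), ?_, ?_⟩
  · refine hmain.trans ?_
    refine mul_le_mul_of_nonneg_right (mul_le_mul_of_nonneg_right ?_ hpow.le) hE0
    nlinarith [mul_pos hκ0 hC₁0]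
  · have t1 := (hc.targetDist_equiv hobs h k (x k) (xhat k) (q k 0)).1
    have t2 := (hc.targetDist_equiv hobs h k₀ (x k₀) (xhat k₀) (q k₀ 0)).2
    calc _ ≤ (1 + κ) * (‖euc (x k - xhat k)‖ + D k) := t1
      _ ≤ (1 + κ) * (C₁ * lam ^ (k - k₀) * (‖euc (x k₀ - xhat k₀)‖ + D k₀)) := by gcongr
      _ ≤ (1 + κ) * (C₁ * lam ^ (k - k₀) * ((2 + κ) *
          Metric.infDist (WithLp.toLp 2 (euc (x k₀ - xhat k₀), euc (q k₀ 0)))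
            (obs.targetSet net k₀ (x k₀)))) := by gcongr
      _ = _ := by ring

end Interconnection

end DistObs

namespace DistObs

/-! ### Uniform bounds for ADMM over a compact set of cost Hessians -/

section Compactness

variable {n p q : Type*} [Fintype n] [Fintype p] [Fintype q]
  [DecidableEq p] [DecidableEq q]

lemma continuousOn_matrix_inv [DecidableEq n] {X : Type*} [TopologicalSpace X] {s : Set X} {f : X → Matrix n n ℝ}
    (hf : ContinuousOn f s) (hu : ∀ x ∈ s, IsUnit (f x)) : ContinuousOn (fun x => (f x)⁻¹) s := by
  intro x hx
  obtain ⟨u, hu⟩ := hu x hx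
  have h1 : ContinuousAt Ring.inverse (f x) := hu ▸ NormedRing.inverse_continuousAt u
  simp only [Matrix.nonsing_inv_eq_ringInverse]
  exact h1.comp_continuousWithinAt (hf x hx)

/-- Cost Hessians bounded by `b` whose global information matrix is bounded below by `s`. -/
def boundedCosts (E : Matrix p n ℝ) (b s : ℝ) : Set (Matrix p p ℝ) :=
  {Q | ‖Q‖ ≤ b ∧ Q.PosSemidef ∧ ∀ x : n → ℝ, s * ‖euc x‖ ^ 2 ≤ x ⬝ᵥ ((Eᵀ * Q * E) *ᵥ x)}

lemma isCompact_boundedCosts (E : Matrix p n ℝ) (b s : ℝ) : IsCompact (boundedCosts E b s) := by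
  have : ProperSpace (Matrix p p ℝ) := FiniteDimensional.proper ℝ _
  refine Metric.isCompact_of_isClosed_isBounded ?_ ?_
  · have h1 : boundedCosts E b s = {Q | ‖Q‖ ≤ b} ∩ ({Q | Qᵀ = Q} ∩ ⋂ v : p → ℝ,
        {Q : Matrix p p ℝ | 0 ≤ v ⬝ᵥ (Q *ᵥ v)}) ∩
        ⋂ x : n → ℝ, {Q | s * ‖euc x‖ ^ 2 ≤ x ⬝ᵥ ((Eᵀ * Q * E) *ᵥ x)} := by
      ext Q
      simp [boundedCosts, posSemidef_iff_real, and_assoc]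
    rw [h1]
    refine ((isClosed_le continuous_norm continuous_const).inter
      ((isClosed_eq (by fun_prop) continuous_id).inter (isClosed_iInter fun v => ?_))).inter
      (isClosed_iInter fun x => ?_)
    · exact isClosed_le continuous_const (by fun_prop)
    · exact isClosed_le continuous_const (by fun_prop)
  · exact (Metric.isBounded_closedBall (x := (0 : Matrix p p ℝ)) (r := b)).subset
      fun Q hQ => by simpa using hQ.1

variable {P : Matrix q q ℝ} {A : Matrix q p ℝ} {E : Matrix p n ℝ} {Sg : Matrix n p ℝ} {ρ : ℝ}

/-- The ADMM quantities are continuous in the cost Hessian, hence uniformly bounded. For the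
pseudo-inverse this uses that the kernel of the residual operator is constant. -/
lemma exists_uniform_admm_bound (h : IsConsensus P A E Sg) (hρ : 0 < ρ) (b : ℝ) {s : ℝ}
    (hs : 0 < s) :
    ∃ C : ℝ, 0 < C ∧ ∀ Q ∈ boundedCosts E b s, ‖(admmHess ρ A Q)⁻¹‖ ≤ C ∧
      ‖admmOp ρ P A Q‖ ≤ C ∧ ∃ B, IsMoorePenrose (admmOp ρ P A Q) B ∧ ‖B‖ ≤ C := by
  obtain ⟨K, hK⟩ := exists_isKernelProj P A
  have hcpt := isCompact_boundedCosts E b s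
  have hS : ∀ Q ∈ boundedCosts E b s, (Eᵀ * Q * E).PosDef := fun Q hQ =>
    posDef_of_lower_bound hs (posSemidef_iff_real.mp (posSemidef_congruence hQ.2.1 E)).1 hQ.2.2
  have hH : ContinuousOn (fun Q => admmHess ρ A Q) (boundedCosts E b s) := by
    unfold admmHess
    fun_prop
  have hHinv : ContinuousOn (fun Q => (admmHess ρ A Q)⁻¹) (boundedCosts E b s) :=
    continuousOn_matrix_inv hH fun Q hQ => (admmHess_posDef h hρ hQ.2.1 (hS Q hQ)).isUnit
  have hF : ContinuousOn (fun Q => admmOp ρ P A Q) (boundedCosts E b s) := by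
    have hmul : Continuous fun M : Matrix p p ℝ =>
        1 + P - (2 * ρ) • (P * A * M * Aᵀ) := by fun_prop
    exact hmul.comp_continuousOn hHinv
  have hB : ContinuousOn (fun Q => (admmOp ρ P A Q + K)⁻¹ - K) (boundedCosts E b s) :=
    (continuousOn_matrix_inv (hF.add continuousOn_const) fun Q hQ =>
      isUnit_admmOp_add h hρ hQ.2.1 (hS Q hQ) hK).sub continuousOn_const
  obtain ⟨C₁, h₁⟩ := hcpt.exists_bound_of_continuousOn hHinv
  obtain ⟨C₂, h₂⟩ := hcpt.exists_bound_of_continuousOn hF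
  obtain ⟨C₃, h₃⟩ := hcpt.exists_bound_of_continuousOn hB
  have l1 := le_abs_self C₁
  have l2 := le_abs_self C₂
  have l3 := le_abs_self C₃
  have p1 := abs_nonneg C₁
  have p2 := abs_nonneg C₂
  have p3 := abs_nonneg C₃
  refine ⟨|C₁| + |C₂| + |C₃| + 1, by positivity, fun Q hQ => ⟨?_, ?_, ?_⟩⟩
  · linarith [h₁ Q hQ]
  · linarith [h₂ Q hQ]
  · exact ⟨_, (isMoorePenrose_admmOp h hρ hQ.2.1 (hS Q hQ) hK).2, by linarith [h₃ Q hQ]⟩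

end Compactness

variable {V : Type*} [Fintype V] [DecidableEq V] {G : SimpleGraph V} {d m ql qr : ℕ}

/-! ### Uniform bounds on the information matrices -/

namespace Network

variable {net : Network G d m ql qr}

lemma transition_surjective (h : ∀ k, IsUnit (net.bigA k)) (k n : ℕ) (v : V × Fin d → ℝ) :
    ∃ w, net.transition k n *ᵥ w = v := by
  induction n generalizing v with
  | zero => exact ⟨v, Matrix.one_mulVec v⟩
  | succ n ih =>
    obtain ⟨w, hw⟩ := ih ((net.bigA (k + n))⁻¹ *ᵥ v)
    refine ⟨w, ?_⟩
    rw [transition, ← Matrix.mulVec_mulVec, hw, Matrix.mulVec_mulVec,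
      Matrix.mul_nonsing_inv _ ((Matrix.isUnit_iff_isUnit_det _).mp (h _)), Matrix.one_mulVec]

lemma norm_transition_mulVec_le {a : ℝ} (ha : ∀ k, ‖net.bigA k‖ ≤ a) (k n : ℕ)
    (v : V × Fin d → ℝ) : ‖euc (net.transition k n *ᵥ v)‖ ≤ a ^ n * ‖euc v‖ := by
  have ha0 : 0 ≤ a := (norm_nonneg _).trans (ha 0)
  induction n with
  | zero => simp [transition]
  | succ n ih =>
    rw [transition, ← Matrix.mulVec_mulVec, pow_succ', mul_assoc]
    exact (norm_euc_mulVec_le _ _).trans (mul_le_mul (ha _) ih (norm_nonneg _) ha0)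

lemma quadForm_gramian (s K : ℕ) (v : V × Fin d → ℝ) :
    v ⬝ᵥ (net.gramian (s + K) K *ᵥ v) =
      ∑ t ∈ Finset.range (K + 1), ‖euc (net.bigH (s + t) *ᵥ (net.transition s t *ᵥ v))‖ ^ 2 := by
  have hI : Finset.Icc s (s + K) = Finset.Ico s (s + (K + 1)) := by
    ext; simp only [Finset.mem_Icc, Finset.mem_Ico]; omega
  rw [gramian, Nat.add_sub_cancel, hI, Finset.sum_Ico_eq_sum_range, Nat.add_sub_cancel_left,
    Matrix.sum_mulVec, dotProduct_sum]
  refine Finset.sum_congr rfl fun t _ => ?_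
  rw [Nat.add_sub_cancel_left, Matrix.mul_assoc, ← Matrix.transpose_mul, quadForm_factor,
    Matrix.mulVec_mulVec]

end Network

namespace Observer

variable [DecidableRel G.Adj] {net : Network G d m ql qr} {obs : Observer G d ql qr}

lemma exists_gain_lower (hobs : obs.Admissible net) :
    ∃ r : ℝ, 0 < r ∧ ∀ k (w : net.MeasIdx → ℝ), r * ‖euc w‖ ^ 2 ≤ w ⬝ᵥ (obs.bigR net k *ᵥ w) := by
  obtain ⟨r₁, hr₁, h₁⟩ := hobs.gain_l
  obtain ⟨r₂, hr₂, h₂⟩ := hobs.gain_r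
  refine ⟨min r₁ r₂, lt_min hr₁ hr₂, fun k w => ?_⟩
  have hw : ‖euc w‖ ^ 2 =
      (∑ i : {i : V // i ∈ net.Vl}, ‖euc fun a => w (Sum.inl (i, a))‖ ^ 2) +
      ∑ e : {e : V × V // e ∈ net.Es}, ‖euc fun a => w (Sum.inr (e, a))‖ ^ 2 := by
    simp only [norm_euc_sq, dotProduct, Fintype.sum_sum_type, Fintype.sum_prod_type]
  rw [bilin_bigR, hw, mul_add, Finset.mul_sum, Finset.mul_sum]
  refine add_le_add (Finset.sum_le_sum fun i _ => ?_) (Finset.sum_le_sum fun e _ => ?_)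
  · exact (mul_le_mul_of_nonneg_right (min_le_left _ _) (sq_nonneg _)).trans
      ((posSemidef_sub_smul_one_iff.mp (h₁ k i.1 i.2)).2 _)
  · exact (mul_le_mul_of_nonneg_right (min_le_right _ _) (sq_nonneg _)).trans
      ((posSemidef_sub_smul_one_iff.mp (h₂ k e.1.1 e.1.2 e.2)).2 _)

/-- Information accumulated along a trajectory, with exponential forgetting. -/
lemma window_information_le (hobs : obs.Admissible net) (h : ∀ k, IsUnit (net.bigA k)) {r : ℝ}
    (hr : 0 < r)
    (hR : ∀ k (w : net.MeasIdx → ℝ), r * ‖euc w‖ ^ 2 ≤ w ⬝ᵥ (obs.bigR net k *ᵥ w))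
    (k n : ℕ) (v : V × Fin d → ℝ) :
    obs.γ ^ n * (obs.ε * r *
        ∑ t ∈ Finset.range n, ‖euc (net.bigH (k + t) *ᵥ (net.transition k t *ᵥ v))‖ ^ 2) ≤
      (net.transition k n *ᵥ v) ⬝ᵥ
        (obs.SPrior net (k + n) *ᵥ (net.transition k n *ᵥ v)) := by
  induction n with
  | zero =>
    simpa using (posSemidef_iff_real.mp (SPrior_posSemidef k hobs h)).2 (net.transition k 0 *ᵥ v)
  | succ n ih =>
    set w := net.transition k n *ᵥ v with hw
    have e1 : net.transition k (n + 1) *ᵥ v = net.bigA (k + n) *ᵥ w := by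
      rw [Network.transition, ← Matrix.mulVec_mulVec]
    rw [e1, ← add_assoc, quadForm_SPrior_succ _ h, Finset.sum_range_succ, SPost, Matrix.add_mulVec,
      dotProduct_add, Matrix.smul_mulVec, dotProduct_smul, smul_eq_mul, dotProduct_congruence,
      pow_succ', mul_assoc]
    refine mul_le_mul_of_nonneg_left ?_ hobs.γ_pos.le
    rw [mul_add, mul_add]
    refine add_le_add ih ?_
    have e2 := mul_le_mul_of_nonneg_left (hR (k + n) (net.bigH (k + n) *ᵥ w)) hobs.ε_pos.le
    have e3 : obs.γ ^ n ≤ 1 := pow_le_one₀ hobs.γ_pos.le hobs.γ_lt.le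
    have e4 : 0 ≤ obs.ε * (r * ‖euc (net.bigH (k + n) *ᵥ w)‖ ^ 2) := by
      have := hobs.ε_pos
      positivity
    rw [mul_assoc obs.ε]
    exact (mul_le_of_le_one_left e4 e3).trans e2

/-- Complete uniform observability bounds the information matrices from below. The observability
Gramian is available only after the first window; up to then the initial information, discounted
boundedly often, gives the bound. -/
lemma exists_info_lower (hobs : obs.Admissible net) (h : ∀ k, IsUnit (net.bigA k))
    (hcuo : net.CompletelyUniformlyObservable) {a : ℝ} (ha0 : 0 < a) (ha : ∀ k, ‖net.bigA k‖ ≤ a) :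
    ∃ s : ℝ, 0 < s ∧ ∀ k (v : V × Fin d → ℝ),
      s * ‖euc v‖ ^ 2 ≤ v ⬝ᵥ (obs.SPrior net k *ᵥ v) := by
  obtain ⟨K, -, α₁, α₂, hα₁, -, hgram⟩ := hcuo
  obtain ⟨r, hr, hR⟩ := exists_gain_lower hobs
  obtain ⟨c₀, hc₀, hS₀⟩ := exists_lower_bound_of_posDef hobs.init_pos
  have hε := hobs.ε_pos
  have hγ := hobs.γ_pos
  set a' := max a 1 with ha'
  have ha'0 : 0 < a' := lt_max_of_lt_left ha0
  have ha'1 : 1 ≤ a' := le_max_right _ _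
  set t := obs.γ / a' ^ 2 with ht
  have ht0 : 0 < t := by positivity
  have ht1 : t ≤ 1 := by
    rw [ht, div_le_one (by positivity)]
    nlinarith [hobs.γ_lt]
  -- during the first window the initial information survives
  have hinit : ∀ k (v : V × Fin d → ℝ),
      c₀ * t ^ k * ‖euc v‖ ^ 2 ≤ v ⬝ᵥ (obs.SPrior net k *ᵥ v) := by
    intro k
    induction k with
    | zero =>
      intro v
      rw [pow_zero, mul_one]
      exact hS₀ v
    | succ k ih =>
      intro v
      obtain ⟨w, rfl⟩ : ∃ w, net.bigA k *ᵥ w = v := by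
        obtain ⟨w, hw⟩ := Network.transition_surjective h k 1 v
        exact ⟨w, by simpa [Network.transition] using hw⟩
      rw [quadForm_SPrior_succ k h]
      have e1 : ‖euc (net.bigA k *ᵥ w)‖ ^ 2 ≤ a' ^ 2 * ‖euc w‖ ^ 2 := by
        rw [← mul_pow]
        gcongr
        exact (norm_euc_mulVec_le _ _).trans
          (mul_le_mul_of_nonneg_right ((ha k).trans (le_max_left _ _)) (norm_nonneg _))
      calc c₀ * t ^ (k + 1) * ‖euc (net.bigA k *ᵥ w)‖ ^ 2
          ≤ c₀ * t ^ (k + 1) * (a' ^ 2 * ‖euc w‖ ^ 2) := by gcongr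
        _ = obs.γ * (c₀ * t ^ k * ‖euc w‖ ^ 2) := by
            rw [pow_succ]
            nth_rewrite 2 [ht]
            field_simp
        _ ≤ _ := by
            gcongr
            exact (ih w).trans (SPrior_le_SPost k hobs w)
  -- afterwards a full observability window is available
  have hwin : ∀ k (v : V × Fin d → ℝ),
      obs.γ ^ (K + 1) * (obs.ε * r * α₁) / (a ^ (K + 1)) ^ 2 * ‖euc v‖ ^ 2 ≤
        v ⬝ᵥ (obs.SPrior net (k + (K + 1)) *ᵥ v) := by
    intro k v
    obtain ⟨w, rfl⟩ := Network.transition_surjective h k (K + 1) v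
    refine le_trans ?_ (window_information_le hobs h hr hR k (K + 1) w)
    rw [← Network.quadForm_gramian]
    have e1 := (posSemidef_sub_smul_one_iff.mp (hgram (k + K) (Nat.le_add_left _ _)).1).2 w
    have e2 : ‖euc (net.transition k (K + 1) *ᵥ w)‖ ^ 2 ≤ (a ^ (K + 1)) ^ 2 * ‖euc w‖ ^ 2 := by
      rw [← mul_pow]
      gcongr
      exact Network.norm_transition_mulVec_le ha k (K + 1) w
    calc _ ≤ obs.γ ^ (K + 1) * (obs.ε * r * α₁) / (a ^ (K + 1)) ^ 2 *
          ((a ^ (K + 1)) ^ 2 * ‖euc w‖ ^ 2) := by gcongr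
      _ = obs.γ ^ (K + 1) * (obs.ε * r * (α₁ * ‖euc w‖ ^ 2)) := by field_simp
      _ ≤ _ := by gcongr
  refine ⟨min (c₀ * t ^ K) (obs.γ ^ (K + 1) * (obs.ε * r * α₁) / (a ^ (K + 1)) ^ 2),
    lt_min (by positivity) (by positivity), fun k v => ?_⟩
  rcases Nat.lt_or_ge K k with hk | hk
  · obtain ⟨j, rfl⟩ := Nat.exists_eq_add_of_le' (Nat.succ_le_of_lt hk)
    exact (mul_le_mul_of_nonneg_right (min_le_right _ _) (sq_nonneg _)).trans (hwin j v)
  · refine (mul_le_mul_of_nonneg_right (min_le_left _ _) (sq_nonneg _)).trans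
      (le_trans ?_ (hinit k v))
    have := pow_le_pow_of_le_one ht0.le ht1 hk
    gcongr

/-- The forgetting factor dominates the expansion of the inverse dynamics, so the information stays
bounded. -/
lemma exists_info_upper (hobs : obs.Admissible net) {aInv : ℝ}
    (hinv : net.UniformlyInvertible aInv) (hγ : obs.γ * aInv ^ 2 < 1) {b r : ℝ}
    (hH : ∀ k, ‖net.bigH k‖ ≤ b) (hR : ∀ k, ‖obs.bigR net k‖ ≤ r) :
    ∃ s : ℝ, 0 < s ∧ ∀ k, ‖obs.SPrior net k‖ ≤ s ∧ ‖obs.SPost net k‖ ≤ s := by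
  have hb : 0 ≤ b := (norm_nonneg _).trans (hH 0)
  have hr : 0 ≤ r := (norm_nonneg _).trans (hR 0)
  have hγ0 := hobs.γ_pos
  have hε0 := hobs.ε_pos
  have ha0 := hinv.1
  set θ := obs.γ * aInv ^ 2 with hθ
  have hθ0 : 0 < θ := by positivity
  have h1θ : 0 < 1 - θ := by linarith
  set j := obs.ε * (b * r * b) with hj
  have hj0 : 0 ≤ j := by positivity
  set M := ‖obs.S0‖ + θ * j / (1 - θ) with hM
  have hM0 : 0 ≤ M := by positivity
  have hMθ : θ * (M + j) ≤ M := by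
    have e1 : (1 - θ) * M = (1 - θ) * ‖obs.S0‖ + θ * j := by
      rw [hM]; field_simp
    nlinarith [mul_nonneg h1θ.le (norm_nonneg obs.S0)]
  have hpost : ∀ k, ‖obs.SPost net k‖ ≤ ‖obs.SPrior net k‖ + j := by
    intro k
    rw [SPost]
    refine (norm_add_le _ _).trans (add_le_add le_rfl ?_)
    rw [norm_smul, Real.norm_of_nonneg hε0.le, hj]
    refine mul_le_mul_of_nonneg_left ?_ hε0.le
    refine (Matrix.l2_opNorm_mul _ _).trans (mul_le_mul ?_ (hH k) (norm_nonneg _) (by positivity))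
    refine (Matrix.l2_opNorm_mul _ _).trans (mul_le_mul ?_ (hR k) (norm_nonneg _) hb)
    rw [opNorm_transpose]
    exact hH k
  have hprior : ∀ k, ‖obs.SPrior net k‖ ≤ M := by
    intro k
    induction k with
    | zero => exact le_add_of_nonneg_right (by positivity)
    | succ k ih =>
      have e1 : ‖obs.SPrior net (k + 1)‖ ≤ obs.γ * (aInv * ‖obs.SPost net k‖ * aInv) := by
        rw [SPrior, norm_smul, Real.norm_of_nonneg hγ0.le]
        refine mul_le_mul_of_nonneg_left ?_ hγ0.le
        have hi := (hinv.2 k).2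
        refine (Matrix.l2_opNorm_mul _ _).trans (mul_le_mul ?_ hi (norm_nonneg _) (by positivity))
        refine (Matrix.l2_opNorm_mul _ _).trans
          (mul_le_mul ?_ le_rfl (norm_nonneg _) ha0.le)
        rw [opNorm_transpose]
        exact hi
      calc _ ≤ _ := e1
        _ = θ * ‖obs.SPost net k‖ := by rw [hθ]; ring
        _ ≤ θ * (M + j) := by gcongr; exact (hpost k).trans (by gcongr)
        _ ≤ M := hMθ
  refine ⟨M + j + 1, by positivity, fun k => ⟨?_, ?_⟩⟩
  · linarith [hprior k]
  · linarith [hprior k, hpost k]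

end Observer

/-! ### Bounds on the distributed contributions -/

section Assemble

lemma norm_euc_block_sq_le {ι : Type*} [Fintype ι] {d : ℕ} (z : ι × Fin d → ℝ) (i : ι) :
    ‖euc (block z i)‖ ^ 2 ≤ ‖euc z‖ ^ 2 := by
  rw [norm_euc_sq, norm_euc_sq]
  simp only [dotProduct, Fintype.sum_prod_type]
  exact Finset.single_le_sum (f := fun i => ∑ a, z (i, a) * z (i, a))
    (fun j _ => Finset.sum_nonneg fun a _ => mul_self_nonneg _) (Finset.mem_univ i)

variable [DecidableRel G.Adj]

/-- All contributions being positive semidefinite, an upper bound on their global sum bounds their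
assembly on the (independent) primal copies. -/
lemma quadForm_assembleCopies_le {Sl : V → Matrix (Fin d) (Fin d) ℝ}
    {Se : G.Dart → Matrix (Fin d ⊕ Fin d) (Fin d ⊕ Fin d) ℝ} {s : ℝ} (hs : 0 ≤ s)
    (hl : ∀ i, (Sl i).PosSemidef) (he : ∀ e, (Se e).PosSemidef)
    (hbd : ∀ v, v ⬝ᵥ (assembleGlobal Sl Se *ᵥ v) ≤ s * ‖euc v‖ ^ 2) (z : PrimalIdx G d → ℝ) :
    z ⬝ᵥ (assembleCopies Sl Se *ᵥ z) ≤
      (s * (Fintype.card V + 2 * Fintype.card G.Dart)) * ‖euc z‖ ^ 2 := by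
  have hl0 := fun i => (posSemidef_iff_real.mp (hl i)).2
  have he0 := fun e => (posSemidef_iff_real.mp (he e)).2
  have hSl : ∀ i y, y ⬝ᵥ (Sl i *ᵥ y) ≤ s * ‖euc y‖ ^ 2 := by
    intro i y
    set v := blockSel d i *ᵥ y with hv
    have h1 : block v i = y := by
      rw [← blockSel_transpose_mulVec, hv, Matrix.mulVec_mulVec, blockSel_transpose_mul_self,
        Matrix.one_mulVec]
    have h2 : ‖euc v‖ ^ 2 = ‖euc y‖ ^ 2 := by
      rw [hv, ← quadForm_factor, blockSel_transpose_mul_self, Matrix.one_mulVec, norm_euc_sq]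
    have h3 := hbd v
    rw [bilin_assembleGlobal, h2] at h3
    refine le_trans ?_ h3
    refine le_trans ?_ (le_add_of_nonneg_right
      (mul_nonneg (by norm_num) (Finset.sum_nonneg fun e _ => he0 e _)))
    have h4 := Finset.single_le_sum (f := fun i => block v i ⬝ᵥ (Sl i *ᵥ block v i))
      (fun j _ => hl0 j _) (Finset.mem_univ i)
    simpa only [h1] using h4
  have hSe : ∀ e y, (1 / 2 : ℝ) * (y ⬝ᵥ (Se e *ᵥ y)) ≤ s * ‖euc y‖ ^ 2 := by
    intro e y
    have hne : e.fst ≠ e.snd := e.adj.ne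
    set v := pairSel d e.fst e.snd *ᵥ y with hv
    have h1 : Sum.elim (block v e.fst) (block v e.snd) = y := by
      rw [← pairSel_transpose_mulVec, hv, Matrix.mulVec_mulVec, pairSel_transpose_mul_self hne,
        Matrix.one_mulVec]
    have h2 : ‖euc v‖ ^ 2 = ‖euc y‖ ^ 2 := by
      rw [hv, ← quadForm_factor, pairSel_transpose_mul_self hne, Matrix.one_mulVec, norm_euc_sq]
    have h3 := hbd v
    rw [bilin_assembleGlobal, h2] at h3
    refine le_trans ?_ h3
    refine le_trans ?_ (le_add_of_nonneg_left (Finset.sum_nonneg fun i _ => hl0 i _))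
    have h4 := Finset.single_le_sum
      (f := fun e : G.Dart => Sum.elim (block v e.fst) (block v e.snd) ⬝ᵥ
        (Se e *ᵥ Sum.elim (block v e.fst) (block v e.snd)))
      (fun j _ => he0 j _) (Finset.mem_univ e)
    simp only [h1] at h4
    linarith
  rw [bilin_assembleCopies, mul_add, add_mul, Finset.mul_sum]
  refine add_le_add ?_ ?_
  · calc _ ≤ ∑ _i : V, s * ‖euc z‖ ^ 2 := Finset.sum_le_sum fun i _ =>
          (hSl i _).trans (mul_le_mul_of_nonneg_left (norm_euc_block_sq_le z _) hs)
      _ = _ := by rw [Finset.sum_const, Finset.card_univ, nsmul_eq_mul]; ring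
  · calc _ ≤ ∑ _e : G.Dart, s * (2 * ‖euc z‖ ^ 2) := Finset.sum_le_sum fun e _ => by
          refine (hSe e _).trans (mul_le_mul_of_nonneg_left ?_ hs)
          have h5 := norm_euc_block_sq_le z (Sum.inl e.fst)
          have h6 := norm_euc_block_sq_le z (Sum.inr e)
          rw [norm_euc_sq] at h5 h6 ⊢
          simp only [dotProduct, Fintype.sum_sum_type, Sum.elim_inl, Sum.elim_inr] at h5 h6 ⊢
          linarith
      _ = _ := by rw [Finset.sum_const, Finset.card_univ, nsmul_eq_mul]; ring

end Assemble

/-! ### Existence of the constants -/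

section Existence

variable [DecidableRel G.Adj] {net : Network G d m ql qr} {obs : Observer G d ql qr}

/-- The bound on `F_k` is used twice, as `‖F_{k+1} - F_k‖ ≤ ‖F_{k+1}‖ + ‖F_k‖`; likewise for
`M_k`. Smallness of the variations is not claimed. -/
theorem exists_valid_constants {aInv : ℝ} (hobs : obs.Admissible net)
    (hbdd : net.UniformlyBounded) (hcuo : net.CompletelyUniformlyObservable)
    (hinv : net.UniformlyInvertible aInv) (hγ : obs.γ * aInv ^ 2 < 1)
    (hR : ∃ r : ℝ, ∀ k, ‖obs.bigR net k‖ ≤ r) : ∃ c : GainConstants, c.Valid net obs := by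
  obtain ⟨a, _, b, _, _, ha0, -, -, -, -, hb⟩ := hbdd
  obtain ⟨r, hr⟩ := hR
  have h : ∀ k, IsUnit (net.bigA k) := fun k => (hinv.2 k).1
  have hε0 := hobs.ε_pos
  have hα0 := hobs.α_pos
  have hρ0 := hobs.ρ_pos
  have hα1 : 0 < 1 - obs.α := by linarith [hobs.α_lt]
  obtain ⟨s, hs0, hs⟩ := Observer.exists_info_lower hobs h hcuo ha0 fun k => (hb k).1
  obtain ⟨S, hS0, hS⟩ := Observer.exists_info_upper hobs hinv hγ (fun k => (hb k).2.2.1) hr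
  have hPrior := fun k => posSemidef_iff_real.mp (Observer.SPrior_posSemidef k hobs h)
  have hPost := fun k => posSemidef_iff_real.mp (Observer.SPost_posSemidef k hobs h)
  have hslow : ∀ k v, s * ‖euc v‖ ^ 2 ≤ v ⬝ᵥ (obs.SPost net k *ᵥ v) := fun k v =>
    (hs k v).trans (Observer.SPrior_le_SPost k hobs v)
  have hSup : ∀ k v, v ⬝ᵥ (obs.SPost net k *ᵥ v) ≤ S * ‖euc v‖ ^ 2 := fun k v =>
    (dotProduct_mulVec_le _ v).trans (mul_le_mul_of_nonneg_right (hS k).2 (sq_nonneg _))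
  set bQ := S * (Fintype.card V + 2 * Fintype.card G.Dart) with hbQ
  have hbQ0 : 0 ≤ bQ := by positivity
  have hQ : ∀ k z, z ⬝ᵥ (obs.hessPost net k *ᵥ z) ≤ bQ * ‖euc z‖ ^ 2 := fun k z =>
    quadForm_assembleCopies_le hS0.le (Observer.SlPost_posSemidef k hobs)
      (Observer.SePost_posSemidef k hobs) (fun v => by
        have := hSup k v
        rwa [← Observer.hessPost_global _ _ _ h, Observer.hessPost,
          copyE_transpose_mul_assembleCopies_mul] at this) z
  have hJ : ∀ k, ‖obs.hessMeas net k‖ ≤ bQ / obs.ε := by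
    intro k
    refine opNorm_le_of_posSemidef (by positivity) (Observer.hessMeas_posSemidef k hobs) fun v => ?_
    have h1 := hQ k v
    have h2 := (posSemidef_iff_real.mp (Observer.hessPrior_posSemidef k hobs)).2 v
    rw [Observer.hessPost_eq, Matrix.add_mulVec, dotProduct_add, Matrix.smul_mulVec,
      dotProduct_smul, smul_eq_mul] at h1
    rw [div_mul_eq_mul_div, le_div_iff₀ hε0]
    linarith
  obtain ⟨C, hC0, hC⟩ := exists_uniform_admm_bound (isConsensus G d) hρ0 bQ hs0
  have hmem : ∀ k, obs.hessPost net k ∈ boundedCosts (copyE G d) bQ s := fun k =>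
    ⟨opNorm_le_of_posSemidef hbQ0 (Observer.hessPost_posSemidef k hobs) (hQ k),
      Observer.hessPost_posSemidef k hobs, fun x => by
        rw [Observer.hessPost_global _ _ _ h]
        exact hslow k x⟩
  have hHinv : ∀ k, ‖(obs.Hrho net k)⁻¹‖ ≤ C := fun k => by
    rw [Observer.Hrho_eq]
    exact (hC _ (hmem k)).1
  have hF : ∀ k, ‖obs.matF net k‖ ≤ C := fun k => by
    rw [Observer.matF_eq]
    exact (hC _ (hmem k)).2.1
  set MB := 2 * obs.ρ * (‖permP G d * matAq G d‖ * C * (bQ / obs.ε * ‖copyE G d‖)) + 1 with hMB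
  have hMB0 : 0 < MB := by positivity
  have hM : ∀ k, ‖obs.matM net k‖ ≤ MB := by
    intro k
    rw [Observer.matM_eq, ← Observer.Hrho_eq, norm_smul, Real.norm_of_nonneg (by positivity)]
    refine le_trans ?_ (le_add_of_nonneg_right zero_le_one)
    refine mul_le_mul_of_nonneg_left ?_ (by positivity)
    refine (Matrix.l2_opNorm_mul _ _).trans
      (mul_le_mul ?_ ?_ (norm_nonneg _) (by positivity))
    · exact (Matrix.l2_opNorm_mul _ _).trans (by gcongr; exact hHinv k)
    · exact (Matrix.l2_opNorm_mul _ _).trans (by gcongr; exact hJ k)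
  -- the summand `1 / α` makes the contraction factor positive
  refine ⟨⟨s, S, a, ‖matSigma G d‖ * C * ‖(matAq G d)ᵀ‖ + 1, C, C + C, MB, MB + MB,
    a * s⁻¹ * S, C / obs.α + 1 / obs.α⟩, ?_⟩
  constructor
  · exact hs0
  · exact hS0
  · exact ha0
  · change 0 < ‖matSigma G d‖ * C * ‖(matAq G d)ᵀ‖ + 1
    positivity
  · exact hC0
  · exact hMB0
  · change 0 < C / obs.α + 1 / obs.α
    positivity
  · exact fun k => posSemidef_sub_smul_one_iff.mpr ⟨(hPrior k).1, hs k⟩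
  · exact fun k => posSemidef_smul_one_sub_iff.mpr ⟨(hPost k).1, hSup k⟩
  · exact fun k => (hb k).1
  · intro k
    refine le_trans ?_ (le_add_of_nonneg_right zero_le_one)
    refine (Matrix.l2_opNorm_mul _ _).trans (mul_le_mul_of_nonneg_right ?_ (norm_nonneg _))
    exact (Matrix.l2_opNorm_mul _ _).trans (by gcongr; exact hHinv k)
  · intro k
    rw [Observer.matF_eq]
    exact (hC _ (hmem k)).2.2
  · exact fun k => (norm_sub_le _ _).trans (add_le_add (hF _) (hF _))
  · exact hM
  · exact fun k => (norm_sub_le _ _).trans (add_le_add (hM _) (hM _))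
  · intro k
    rw [Observer.errPhi]
    refine (Matrix.l2_opNorm_mul _ _).trans (mul_le_mul ?_ (hS k).1 (norm_nonneg _) (by positivity))
    exact (Matrix.l2_opNorm_mul _ _).trans (mul_le_mul (hb k).1
      (opNorm_inv_le_of_lower_bound hs0 (hPost k).1 (hslow k)) (norm_nonneg _) ha0.le)
  · change C / obs.α ≤ C / obs.α + 1 / obs.α
    exact le_add_of_nonneg_right (by positivity)
  · change 0 < 1 - (1 - obs.α) / (obs.α * (C / obs.α + 1 / obs.α) ^ 2)
    have e1 : (1 / obs.α) ^ 2 ≤ (C / obs.α + 1 / obs.α) ^ 2 := by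
      gcongr
      exact le_add_of_nonneg_left (by positivity)
    have e2 : 1 < obs.α * (C / obs.α + 1 / obs.α) ^ 2 := by
      refine lt_of_lt_of_le ?_ (mul_le_mul_of_nonneg_left e1 hα0.le)
      have : obs.α * (1 / obs.α) ^ 2 = 1 / obs.α := by field_simp
      rw [this, lt_one_div one_pos hα0, one_div_one]
      exact hobs.α_lt
    rw [sub_pos, div_lt_one (by linarith)]
    linarith

end Existence

end DistObs

theorem theorem1 {V : Type*} [Fintype V] [DecidableEq V] {G : SimpleGraph V}
    [DecidableRel G.Adj] {d m ql qr : ℕ}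
    (net : Network G d m ql qr) (obs : Observer G d ql qr) (aInv : ℝ)
    (hobs : obs.Admissible net)
    (hbdd : net.UniformlyBounded)
    (hcuo : net.CompletelyUniformlyObservable)
    (hinv : net.UniformlyInvertible aInv) :
    -- the constants entering the small-gain condition are finite
    (obs.γ * aInv ^ 2 < 1 → (∃ r : ℝ, ∀ k, ‖obs.bigR net k‖ ≤ r) →
      ∃ c : GainConstants, c.Valid net obs) ∧
    -- and under the small-gain condition the interconnection is exponentially stable
    (∀ c : GainConstants, c.Valid net obs →
      obs.ε < (1 - √obs.γ) * (1 - c.μ obs.α ^ obs.nIter) /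
        (c.c12 * c.c21 + (1 - √obs.γ) * c.c22) →
      ∃ C lam : ℝ, 0 < C ∧ 0 < lam ∧ lam < 1 ∧
        ∀ (k₀ : ℕ) (x xhat : ℕ → V × Fin d → ℝ) (q : ℕ → ℕ → DualIdx G d → ℝ),
          obs.IsSolution net k₀ x xhat q → ∀ k, k₀ ≤ k →
            (obs.Qeq net k (x k) (xhat k)).Nonempty ∧
            (obs.targetSet net k (x k)).Nonempty ∧
            ‖euc (x k - xhat k)‖ +
                Metric.infDist (euc (q k 0)) (obs.Qeq net k (x k) (xhat k)) ≤
              C * lam ^ (k - k₀) *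
                (‖euc (x k₀ - xhat k₀)‖ +
                  Metric.infDist (euc (q k₀ 0)) (obs.Qeq net k₀ (x k₀) (xhat k₀))) ∧
            Metric.infDist (WithLp.toLp 2 (euc (x k - xhat k), euc (q k 0)))
                (obs.targetSet net k (x k)) ≤
              C * lam ^ (k - k₀) *
                Metric.infDist (WithLp.toLp 2 (euc (x k₀ - xhat k₀), euc (q k₀ 0)))
                  (obs.targetSet net k₀ (x k₀))) := by
  have h : ∀ k, IsUnit (net.bigA k) := fun k => (hinv.2 k).1
  exact ⟨fun hγ hR => exists_valid_constants hobs hbdd hcuo hinv hγ hR,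
    fun c hc hε => exponential_stability hc hobs h hε⟩
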